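/- Let $d\ge 1$ and write $|\cdot|$ for the Euclidean norm and $\ell$ for Lebesgue measure on $\mathbb R^d$. Let $g:[0,\infty)\to[0,1]$ be non-increasing with $0<\int_{\mathbb R^d} g(|x|)\,dx<\infty$. Let $K\subset\mathbb R^d$ be a bounded Borel set with non-empty interior and $\ell(\partial K)=0$, let $\lambda>0$, and let $\lambda_n>0$ $(n\ge 1)$ satisfy $\lambda_n/n^d\to\lambda$. For a measurable $h:[0,\infty)\to[0,1]$ and $\mu>0$, the Poisson random connection model $(X,\mu,h)$ has as vertices the points of a homogeneous Poisson process $X$ on $\mathbb R^d$ with density $\mu$; given $X$, any two different points $x,y$ of $X$ are connected with probability $h(|x-y|)$, independently for different pairs. Models with the same $X$ and different $h$ are coupled in the standard way: independently of $X$, the pairs of points carry independent marks, uniform on $[0,1]$, and $x,y$ are connected for $h$ if and only if the mark of the pair is less than $h(|x-y|)$. Fix $R>0$ and put, for $r\ge 0$ and $n\ge 1$, $$g_R(r)=1_{\{r\le R\}}g(r),\quad g^R(r)=1_{\{r>R\}}g(r),\quad g_n(r)=g(nr),\quad g_{R,n}(r)=1_{\{r\le R/n\}}g(nr).$$ Let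 $X_n$ be a Poisson process on $\mathbb R^d$ with density $\lambda_n$, and let $L_{R,n}(g)$ be the number of isolated vertices of $(X_n,\lambda_n,g_{R,n})$ in $K$ that are not isolated in $(X_n,\lambda_n,g_n)$. For $\mu>0$ put $$p(\mu,h)=e^{-\mu\int_{\mathbb R^d}h(|y|)\,dy},\qquad p_\mu^{h_1,h_2}(x_1,x_2)=e^{\mu\int_{\mathbb R^d}h_1(|y-x_1|)\,h_2(|y-x_2|)\,dy}.$$ Then, for every $n\ge1$, $L_{R,n}(g)$ is almost surely finite and has a finite second moment, the two integrals over $x$ below converge absolutely, and $$\lim_{n\to\infty}(\lambda_n\ell(K))^{-1}\,\mathbb E L_{R,n}(g)=p(\lambda,g_R)\bigl(1-p(\lambda,g^R)\bigr),$$ $$\begin{aligned}\lim_{n\to\infty}(\lambda_n\ell(K))^{-1}\,\mathrm{Var}\,L_{R,n}(g)={}&p(\lambda,g_R)\bigl(1-p(\lambda,g^R)\bigr)\\ &+\lambda\int_{\mathbb R^d}\Bigl\{(1-g(|x|))\Bigl[p(\lambda,g_R)^2\,p_\lambda^{g_R,g_R}(x,0)-2\,p(\lambda,g_R)^2\,p(\lambda,g^R)\,p_\lambda^{g_R,g}(x,0)\\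 &\qquad\qquad+p(\lambda,g)^2\,p_\lambda^{g,g}(x,0)\Bigr]-p(\lambda,g_R)^2\bigl(1-p(\lambda,g^R)\bigr)^2\Bigr\}\,dx\\ &+\lambda\,p(\lambda,g_R)^2\int_{\mathbb R^d}g^R(|x|)\,p_\lambda^{g_R,g_R}(x,0)\,dx.\end{aligned}$$ -/

import Mathlib

open MeasureTheory ProbabilityTheory Filter Topology

noncomputable section

namespace RandomConnection

/-- The space `ℝ^d` with its Euclidean norm. -/
abbrev E (d : ℕ) : Type := EuclideanSpace ℝ (Fin d)

/-- A connection function in dimension `d`: a non-increasing map `[0,∞) → [0,1]` with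
`0 < ∫ g(|x|) dx < ∞`. Only the values on `[0,∞)` matter. -/
structure IsConnectionFunction (d : ℕ) (g : ℝ → ℝ) : Prop where
  mem_Icc : ∀ r, 0 ≤ r → g r ∈ Set.Icc (0 : ℝ) 1
  antitoneOn : AntitoneOn g (Set.Ici 0)
  integrable : Integrable (fun y : E d => g ‖y‖) volume
  integral_pos : 0 < ∫ y : E d, g ‖y‖

/-- `h_R(r) = 1_{r ≤ R} h(r)`. -/
def truncBelow (R : ℝ) (h : ℝ → ℝ) : ℝ → ℝ := fun r => if r ≤ R then h r else 0

/-- `h^R(r) = 1_{r > R} h(r)`. -/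
def truncAbove (R : ℝ) (h : ℝ → ℝ) : ℝ → ℝ := fun r => if R < r then h r else 0

/-- `g_n(r) = g(n r)`. -/
def scale (n : ℕ) (g : ℝ → ℝ) : ℝ → ℝ := fun r => g (n * r)

/-- `p(μ,h) = exp(-μ ∫ h(|y|) dy)`, the integral being over `ℝ^d`. -/
def p (d : ℕ) (μ : ℝ) (h : ℝ → ℝ) : ℝ := Real.exp (-μ * ∫ y : E d, h ‖y‖)

/-- `p_μ^{h₁,h₂}(x₁,x₂) = exp(μ ∫ h₁(|y-x₁|) h₂(|y-x₂|) dy)`. -/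
def pp {d : ℕ} (μ : ℝ) (h₁ h₂ : ℝ → ℝ) (x₁ x₂ : E d) : ℝ :=
  Real.exp (μ * ∫ y : E d, h₁ ‖y - x₁‖ * h₂ ‖y - x₂‖)

/-- The number of points of the enumerated configuration `x` in the set `B`. -/
def count {d : ℕ} (x : ℕ → E d) (B : Set (E d)) : ℕ∞ := {i : ℕ | x i ∈ B}.encard

/-- The points `ξ 0, ξ 1, …` form a homogeneous Poisson process on `ℝ^d` with density `lam`:
the number of points in a Borel set of finite volume is Poisson distributed with mean `lam` times
the volume, and the numbers of points in disjoint Borel sets are independent. -/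
structure IsPoissonProcess {d : ℕ} {Ω : Type*} [MeasurableSpace Ω] (P : Measure Ω) (lam : ℝ)
    (ξ : ℕ → Ω → E d) : Prop where
  measurable : ∀ i, Measurable (ξ i)
  hasLaw_count : ∀ B : Set (E d), MeasurableSet B → volume B ≠ ⊤ →
    HasLaw (fun ω => count (fun i => ξ i ω) B)
      ((poissonMeasure (lam * volume.real B).toNNReal).map (fun k : ℕ => (k : ℕ∞))) P
  indep_count : ∀ (m : ℕ) (B : Fin m → Set (E d)), (∀ k, MeasurableSet (B k)) →
    Pairwise (Function.onFun Disjoint B) →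
    iIndepFun (fun k ω => count (fun i => ξ i ω) (B k)) P

/-- A Poisson process of density `lam` with independent marks, uniform on `[0,1]`, attached to the
unordered pairs of points and independent of the points. For every connection function `h` it
carries the Poisson random connection model `(X,lam,h)`, see `graph`. -/
structure IsMarkedPoissonProcess {d : ℕ} {Ω : Type*} [MeasurableSpace Ω] (P : Measure Ω)
    (lam : ℝ) (ξ : ℕ → Ω → E d) (u : Sym2 ℕ → Ω → ℝ) : Prop where
  poisson : IsPoissonProcess P lam ξ
  measurable_mark : ∀ e, Measurable (u e)
  hasLaw_mark : ∀ e, HasLaw (u e) (volume.restrict (Set.Icc (0 : ℝ) 1)) P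
  indep_mark : iIndepFun u P
  indep_points_marks : IndepFun (fun ω i => ξ i ω) (fun ω e => u e ω) P

/-- The random connection model with connection function `h`: two different points `x i`, `x j`
are connected when their mark is below `h(|x i - x j|)`. Given the points, the different pairs are
thus connected independently with probabilities `h(|x i - x j|)`; and since the marks do not
depend on `h`, a connection for `h` is also a connection for every larger function. -/
def graph {d : ℕ} (h : ℝ → ℝ) (x : ℕ → E d) (u : Sym2 ℕ → ℝ) : SimpleGraph ℕ where
  Adj i j := i ≠ j ∧ u s(i, j) < h ‖x i - x j‖
  symm := ⟨fun i j hij => ⟨hij.1.symm, by rw [Sym2.eq_swap, norm_sub_rev]; exact hij.2⟩⟩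
  loopless := ⟨fun _ hi => hi.1 rfl⟩

/-- The vertices in `K` that are isolated for the connection function `h₁` but not isolated for
the connection function `h₂`. -/
def lostIsolated {d : ℕ} (K : Set (E d)) (h₁ h₂ : ℝ → ℝ) (x : ℕ → E d) (u : Sym2 ℕ → ℝ) :
    Set ℕ :=
  {i | x i ∈ K ∧ (graph h₁ x u).IsIsolated i ∧ ¬ (graph h₂ x u).IsIsolated i}

/-- The vertices counted by `L_{R,n}(g)`: the isolated vertices in `K` of the model with
connection function `g_{R,n}(r) = 1_{r ≤ R/n} g(n r)` that are not isolated in the model with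
connection function `g_n`. -/
def setL {d : ℕ} (K : Set (E d)) (g : ℝ → ℝ) (R : ℝ) (n : ℕ) (x : ℕ → E d)
    (u : Sym2 ℕ → ℝ) : Set ℕ :=
  lostIsolated K (truncBelow (R / n) (scale n g)) (scale n g) x u

/-- The random variable `L_{R,n}(g)` on the probability space of the model. -/
def L {d : ℕ} {Ω : Type*} (K : Set (E d)) (g : ℝ → ℝ) (R : ℝ) (n : ℕ) (ξ : ℕ → Ω → E d)
    (u : Sym2 ℕ → Ω → ℝ) (ω : Ω) : ℝ :=
  ((setL K g R n (fun i => ξ i ω) (fun e => u e ω)).ncard : ℝ)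

/-- The integrand of the first integral in the limit of the variance. -/
def varIntegrand {d : ℕ} (lam : ℝ) (g : ℝ → ℝ) (R : ℝ) (x : E d) : ℝ :=
  (1 - g ‖x‖) *
      (p d lam (truncBelow R g) ^ 2 * pp lam (truncBelow R g) (truncBelow R g) x 0
        - 2 * p d lam (truncBelow R g) ^ 2 * p d lam (truncAbove R g)
            * pp lam (truncBelow R g) g x 0
        + p d lam g ^ 2 * pp lam g g x 0)
    - p d lam (truncBelow R g) ^ 2 * (1 - p d lam (truncAbove R g)) ^ 2

/-- The integrand of the second integral in the limit of the variance. -/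
def extraIntegrand {d : ℕ} (lam : ℝ) (g : ℝ → ℝ) (R : ℝ) (x : E d) : ℝ :=
  truncAbove R g ‖x‖ * pp lam (truncBelow R g) (truncBelow R g) x 0

end RandomConnection

end

/-!
The number of vertices that lose their isolation when long edges are added is a difference
`S_h - S_{h'}`, where `S_h` is the number of vertices in `K` that are isolated for the connection
function `h`, with `h = g_{R,n} ≤ h' = g_n`. Its first two moments are computed exactly, and the
limits follow by scaling and dominated convergence.

*Moments.* Given the points, the marks of different pairs are independent, so the conditional
probability that one point (or each of two given points) is isolated is a product over the other
points. The expectation of a sum over points, or over pairs of points, of such products is given by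
the Mecke formula. Only counts of points in disjoint sets are available, so the Mecke formula is
first proved for functions that are constant on the cells of a finite partition: grouping the
points by cells turns the sums into products of terms `(N)_m s^(N - m)` with falling factorials of
the independent Poisson counts `N` of the cells, and `E (N)_m s^(N - m) = μ^m e^{-μ(1 - s)}`
(`IsPoissonProcess.integral_pairSum_simpleFunc`). Applied to products of sets this shows that the
second factorial moment measure has density `λ²`, so that the pairs of points avoid null sets
(`IsPoissonProcess.ae_pairs_of_ae`). As `h(|x - y|)` with monotone `h` and the indicator of `K` are
continuous almost everywhere, approximating the points by simple functions and dominated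
convergence give the Mecke formulas for these functions, in a bounded window
(`IsPoissonProcess.integral_singleSum`, `IsPoissonProcess.integral_pairSum`). Letting the window
grow gives `E S_h` and `E S_h S_{h'}`, hence both moments of `S_h - S_{h'}`
(`IsMarkedPoissonProcess.moments_lostIsolated`).

*Limits.* The substitution `w = n (x - y)` turns the variance into an integral over
`x ∈ K` and `w ∈ ℝ^d` of a covariance density with parameter `λ_n / n^d`, restricted to
`x - w / n ∈ K`. The covariance density at `w` is at most a constant times
`g(|w|) + ∫ g(|v - w|) g(|v|) dv` (`abs_covDensity_le`), which is integrable since `g(|·|)` is; and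
since the boundary of `K` is a null set, the restriction on `w` disappears in the limit for almost
every `x ∈ K` (`tendsto_setIntegral_covDensity`).
-/


namespace RandomConnection

open scoped NNReal Nat

/-! ### Factorial moments of the Poisson distribution -/

/-- The factorial-moment identity `E (N)_m s^(N - m) = r^m e^{-r(1 - s)}` for a Poisson variable `N`
with mean `r`: the terms with `N < m` vanish, and an index shift leaves the exponential series. -/
lemma hasSum_poisson_descFactorial (r : ℝ) (m : ℕ) (s : ℝ) :
    HasSum (fun n : ℕ => Real.exp (-r) * r ^ n / n ! * (n.descFactorial m * s ^ (n - m)))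
      (r ^ m * Real.exp (-(r * (1 - s)))) := by
  have h0 : HasSum (fun k : ℕ => Real.exp (-r) * r ^ m * ((r * s) ^ k / k !))
      (Real.exp (-r) * r ^ m * Real.exp (r * s)) := by
    have := NormedSpace.expSeries_div_hasSum_exp (r * s)
    rw [← Real.exp_eq_exp_ℝ] at this
    exact this.mul_left _
  have h1 : Real.exp (-r) * r ^ m * Real.exp (r * s) = r ^ m * Real.exp (-(r * (1 - s))) := by
    rw [mul_comm (Real.exp (-r)), mul_assoc, ← Real.exp_add]; ring_nf
  rw [h1] at h0
  have hinj : Function.Injective (fun k : ℕ => k + m) := add_left_injective m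
  rw [← hinj.hasSum_iff]
  · convert h0 using 2 with k
    have hf : (k ! : ℝ) * ((k + m).descFactorial m) = (k + m)! := by
      have := Nat.factorial_mul_descFactorial (Nat.le_add_left m k)
      rw [Nat.add_sub_cancel] at this
      exact_mod_cast this
    have hk : (k ! : ℝ) ≠ 0 := by positivity
    have hkm : ((k + m)! : ℝ) ≠ 0 := by positivity
    simp only [Function.comp, Nat.add_sub_cancel]
    rw [div_mul_eq_mul_div, ← mul_div_assoc, div_eq_div_iff hkm hk, ← hf]
    ring
  · intro n hn
    have : n < m := by
      by_contra h
      exact hn ⟨n - m, Nat.sub_add_cancel (not_lt.mp h)⟩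
    simp [Nat.descFactorial_of_lt this]

lemma integral_descFactorial_poissonMeasure (r : ℝ≥0) (m : ℕ) (s : ℝ) :
    ∫ n : ℕ, (n.descFactorial m : ℝ) * s ^ (n - m) ∂(poissonMeasure r)
      = r ^ m * Real.exp (-(r * (1 - s))) := by
  rw [integral_poissonMeasure]
  exact (hasSum_poisson_descFactorial r m s).tsum_eq

lemma integrable_sq_poissonMeasure (r : ℝ≥0) :
    Integrable (fun n : ℕ => (n : ℝ) ^ 2) (poissonMeasure r) := by
  rw [integrable_poissonMeasure_iff]
  have h1 := (hasSum_poisson_descFactorial r 1 1).summable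
  have h2 := (hasSum_poisson_descFactorial r 2 1).summable
  convert h1.add h2 using 2 with n
  rw [← mul_add]
  congr 1
  rcases n with _ | n
  · simp
  · simp [Nat.descFactorial_succ]; ring

/-! ### Sums over distinct points of a finite configuration -/

section Combinatorics

variable {γ : Type*}

/-- The sum of `G(x_i) ∏_{k ≠ i} F(x_i, x_k)` over `i ∈ S`. -/
def singleSum (S : Finset ℕ) (x : ℕ → γ) (G : γ → ℝ) (F : γ → γ → ℝ) : ℝ :=
  ∑ i ∈ S, G (x i) * ∏ k ∈ S.erase i, F (x i) (x k)

/-- The sum of `G(x_i, x_j) ∏_{k ≠ i, j} F(x_i, x_j, x_k)` over ordered pairs of different indices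
`i, j ∈ S`. -/
def pairSum (S : Finset ℕ) (x : ℕ → γ) (G : γ → γ → ℝ) (F : γ → γ → γ → ℝ) : ℝ :=
  ∑ i ∈ S, ∑ j ∈ S.erase i, G (x i) (x j) * ∏ k ∈ (S.erase i).erase j, F (x i) (x j) (x k)

variable [DecidableEq γ]

/-- The multiplicity of `e` among `a, b`. -/
def mult (a b e : γ) : ℕ := (if e = a then 1 else 0) + (if e = b then 1 else 0)

lemma prod_eq_prod_pow_card (S : Finset ℕ) (T : Finset γ) (x : ℕ → γ) (hT : ∀ i ∈ S, x i ∈ T)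
    (f : γ → ℝ) : ∏ k ∈ S, f (x k) = ∏ e ∈ T, f e ^ (S.filter (fun k => x k = e)).card := by
  rw [← Finset.prod_fiberwise_of_maps_to hT]
  refine Finset.prod_congr rfl fun e _ => ?_
  rw [Finset.prod_congr rfl (g := fun _ => f e)]
  · simp
  · intro k hk
    rw [(Finset.mem_filter.mp hk).2]

lemma sum_eq_sum_card_mul (S : Finset ℕ) (T : Finset γ) (x : ℕ → γ) (hT : ∀ i ∈ S, x i ∈ T)
    (f : γ → ℝ) : ∑ k ∈ S, f (x k) = ∑ e ∈ T, (S.filter (fun k => x k = e)).card * f e := by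
  rw [← Finset.sum_fiberwise_of_maps_to hT]
  refine Finset.sum_congr rfl fun e _ => ?_
  rw [Finset.sum_congr rfl (g := fun _ => f e)]
  · simp
  · intro k hk
    rw [(Finset.mem_filter.mp hk).2]

lemma card_filter_erase (S : Finset ℕ) (x : ℕ → γ) (i : ℕ) (hi : i ∈ S) (e : γ) :
    ((S.erase i).filter (fun k => x k = e)).card
      = (S.filter (fun k => x k = e)).card - (if e = x i then 1 else 0) := by
  rw [Finset.filter_erase]
  split_ifs with h
  · rw [Finset.card_erase_of_mem]
    simp [hi, h]
  · rw [Finset.erase_eq_of_notMem]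
    · simp
    · simp [Ne.symm h]

/-- The sum grouped by the values taken by `x`: it depends on `x` only through the multiplicities. -/
lemma singleSum_eq (S : Finset ℕ) (T : Finset γ) (x : ℕ → γ) (hT : ∀ i ∈ S, x i ∈ T)
    (G : γ → ℝ) (F : γ → γ → ℝ) :
    singleSum S x G F = ∑ a ∈ T, G a * ∏ e ∈ T,
      (((S.filter (fun k => x k = e)).card.descFactorial (if e = a then 1 else 0) : ℝ) *
        F a e ^ ((S.filter (fun k => x k = e)).card - (if e = a then 1 else 0))) := by
  obtain ⟨f, hf⟩ : ∃ f : γ → ℝ, f = fun a => G a * ∏ e ∈ T,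
      F a e ^ ((S.filter (fun k => x k = e)).card - (if e = a then 1 else 0)) := ⟨_, rfl⟩
  have h1 : ∀ i ∈ S, G (x i) * ∏ k ∈ S.erase i, F (x i) (x k) = f (x i) := by
    intro i hi
    rw [hf]
    rw [prod_eq_prod_pow_card (S.erase i) T x (fun k hk => hT k (Finset.mem_of_mem_erase hk))]
    simp only [card_filter_erase S x i hi]
  refine (Finset.sum_congr rfl h1).trans ((sum_eq_sum_card_mul S T x hT f).trans ?_)
  refine Finset.sum_congr rfl fun a ha => ?_
  rw [hf, Finset.prod_mul_distrib, Finset.prod_eq_single a (fun e _ he => by simp [he])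
    (fun h => absurd ha h)]
  simp only [if_true, Nat.descFactorial_one]
  ring

/-- The product over all values `e` of the falling factorials `(n_e)_{mult a b e}` is the number of
ordered pairs of different indices with values `a` and `b`. -/
lemma prod_descFactorial_mult (T : Finset γ) (n : γ → ℕ) {a b : γ} (ha : a ∈ T) (hb : b ∈ T) :
    ∏ e ∈ T, ((n e).descFactorial (mult a b e) : ℝ)
      = n a * ((n b - (if b = a then 1 else 0) : ℕ) : ℝ) := by
  by_cases hab : a = b
  · subst hab
    rw [Finset.prod_eq_single a (fun e _ he => by simp [mult, he]) (fun h => absurd ha h)]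
    simp only [mult, if_true, Nat.reduceAdd]
    rw [show (n a).descFactorial 2 = (n a - 1) * n a by
      rw [Nat.descFactorial_succ, Nat.descFactorial_one]]
    push_cast
    ring
  · rw [Finset.prod_eq_mul a b hab (fun e _ he => by simp [mult, he.1, he.2])
      (fun h => absurd ha h) (fun h => absurd hb h)]
    simp [mult, hab, Ne.symm hab]

/-- The sum over pairs grouped by the values taken by `x`: it depends on `x` only through the
multiplicities. -/
lemma pairSum_eq (S : Finset ℕ) (T : Finset γ) (x : ℕ → γ) (hT : ∀ i ∈ S, x i ∈ T)
    (G : γ → γ → ℝ) (F : γ → γ → γ → ℝ) :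
    pairSum S x G F = ∑ a ∈ T, ∑ b ∈ T, G a b * ∏ e ∈ T,
      (((S.filter (fun k => x k = e)).card.descFactorial (mult a b e) : ℝ) *
        F a b e ^ ((S.filter (fun k => x k = e)).card - mult a b e)) := by
  set n : γ → ℕ := fun e => (S.filter (fun k => x k = e)).card with hn
  set ψ : γ → γ → ℝ := fun a b => G a b * ∏ e ∈ T, F a b e ^ (n e - mult a b e) with hψ
  obtain ⟨f, hf⟩ : ∃ f : γ → ℝ, f = fun a =>
      ∑ b ∈ T, ((n b - (if b = a then 1 else 0) : ℕ) : ℝ) * ψ a b := ⟨_, rfl⟩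
  have h1 : ∀ i ∈ S, ∑ j ∈ S.erase i, G (x i) (x j) *
      ∏ k ∈ (S.erase i).erase j, F (x i) (x j) (x k) = f (x i) := by
    intro i hi
    have h2 : ∀ j ∈ S.erase i, G (x i) (x j) *
      ∏ k ∈ (S.erase i).erase j, F (x i) (x j) (x k) = ψ (x i) (x j) := by
      intro j hj
      rw [prod_eq_prod_pow_card ((S.erase i).erase j) T x
        (fun k hk => hT k (Finset.mem_of_mem_erase (Finset.mem_of_mem_erase hk)))]
      simp only [card_filter_erase _ x j hj, card_filter_erase S x i hi, Nat.sub_sub, hψ, hn, mult]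
    refine (Finset.sum_congr rfl h2).trans ((sum_eq_sum_card_mul (S.erase i) T x
      (fun k hk => hT k (Finset.mem_of_mem_erase hk)) _).trans ?_)
    simp only [card_filter_erase S x i hi, hn, hf]
  refine (Finset.sum_congr rfl h1).trans ((sum_eq_sum_card_mul S T x hT f).trans ?_)
  refine Finset.sum_congr rfl fun a ha => ?_
  rw [hf, Finset.mul_sum]
  refine Finset.sum_congr rfl fun b hb => ?_
  rw [Finset.prod_mul_distrib, prod_descFactorial_mult T n ha hb]
  simp only [hψ, hn]
  ring

end Combinatorics

end RandomConnection

namespace RandomConnection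

/-! ### Poisson processes seen through finitely many cells -/

variable {d : ℕ} {Ω : Type*} [MeasurableSpace Ω] {P : Measure Ω} {lam : ℝ} {ξ : ℕ → Ω → E d}

open Classical in
/-- The indices of the points of the configuration `x` that lie in `B`; by convention empty if
there are infinitely many of them. -/
noncomputable def window (x : ℕ → E d) (B : Set (E d)) : Finset ℕ :=
  if h : {i | x i ∈ B}.Finite then h.toFinset else ∅

lemma mem_window {x : ℕ → E d} {B : Set (E d)} (h : {i | x i ∈ B}.Finite) {i : ℕ} :
    i ∈ window x B ↔ x i ∈ B := by
  simp [window, h]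

lemma mem_of_mem_window {x : ℕ → E d} {B : Set (E d)} {i : ℕ} (hi : i ∈ window x B) :
    x i ∈ B := by
  unfold window at hi
  split_ifs at hi with h
  · simpa using hi
  · simp at hi

lemma card_window (x : ℕ → E d) (B : Set (E d)) :
    (window x B).card = (count x B).toNat := by
  unfold window count
  split_ifs with h
  · rw [← Set.ncard_def, Set.ncard_eq_toFinset_card _ h]
  · rw [Set.Infinite.encard_eq h]; simp

lemma window_filter_eq {γ : Type*} [DecidableEq γ] {x : ℕ → E d} {B : Set (E d)}
    (h : {i | x i ∈ B}.Finite) (c : E d → γ) (e : γ) :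
    (window x B).filter (fun k => c (x k) = e) = window x (B ∩ c ⁻¹' {e}) := by
  have h' : {i | x i ∈ B ∩ c ⁻¹' {e}}.Finite := h.subset fun i hi => hi.1
  ext i
  simp [mem_window h, mem_window h']

/-- The number of points in a set of finite volume is Poisson distributed. -/
lemma IsPoissonProcess.hasLaw_card (hP : IsPoissonProcess P lam ξ) {B : Set (E d)}
    (hB : MeasurableSet B) (hB' : volume B ≠ ⊤) :
    HasLaw (fun ω => (window (fun i => ξ i ω) B).card)
      (poissonMeasure (lam * volume.real B).toNNReal) P := by
  simp only [card_window]
  have h1 := hP.hasLaw_count B hB hB'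
  have h2 : HasLaw ENat.toNat (poissonMeasure (lam * volume.real B).toNNReal)
      ((poissonMeasure (lam * volume.real B).toNNReal).map (fun k : ℕ => (k : ℕ∞))) := by
    refine ⟨Measurable.of_discrete.aemeasurable, ?_⟩
    rw [Measure.map_map Measurable.of_discrete Measurable.of_discrete]
    convert Measure.map_id
    ext k
    simp
  exact h2.comp h1

lemma IsPoissonProcess.ae_finite (hP : IsPoissonProcess P lam ξ) {B : Set (E d)}
    (hB : MeasurableSet B) (hB' : volume B ≠ ⊤) :
    ∀ᵐ ω ∂P, {i | ξ i ω ∈ B}.Finite := by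
  have h1 := hP.hasLaw_count B hB hB'
  have h2 : ∀ᵐ ω ∂P, count (fun i => ξ i ω) B ≠ ⊤ := by
    rw [h1.ae_iff (p := fun n => n ≠ ⊤) Measurable.of_discrete,
      ae_map_iff Measurable.of_discrete.aemeasurable (.of_discrete)]
    exact ae_of_all _ fun n => ENat.natCast_ne_top n
  filter_upwards [h2] with ω hω
  exact Set.encard_ne_top_iff.mp hω

lemma IsPoissonProcess.integrable_card_sq (hP : IsPoissonProcess P lam ξ) {B : Set (E d)}
    (hB : MeasurableSet B) (hB' : volume B ≠ ⊤) :
    Integrable (fun ω => ((window (fun i => ξ i ω) B).card : ℝ) ^ 2) P := by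
  have h := hP.hasLaw_card hB hB'
  have := integrable_sq_poissonMeasure (lam * volume.real B).toNNReal
  rw [← h.map_eq] at this
  exact this.comp_aemeasurable h.aemeasurable

lemma IsPoissonProcess.integral_descFactorial (hP : IsPoissonProcess P lam ξ) (hlam : 0 ≤ lam)
    {B : Set (E d)} (hB : MeasurableSet B) (hB' : volume B ≠ ⊤) (m : ℕ) (s : ℝ) :
    ∫ ω, ((window (fun i => ξ i ω) B).card.descFactorial m : ℝ) *
        s ^ ((window (fun i => ξ i ω) B).card - m) ∂P
      = (lam * volume.real B) ^ m * Real.exp (-(lam * volume.real B * (1 - s))) := by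
  have h := (hP.hasLaw_card hB hB').integral_comp
    (f := fun n : ℕ => (n.descFactorial m : ℝ) * s ^ (n - m))
    Measurable.of_discrete.aestronglyMeasurable
  have h0 : 0 ≤ lam * volume.real B := by positivity
  rw [integral_descFactorial_poissonMeasure, Real.coe_toNNReal _ h0] at h
  exact h

/-- The numbers of points in the cells of a finite measurable partition of `B` are independent. -/
lemma IsPoissonProcess.iIndepFun_card (hP : IsPoissonProcess P lam ξ) {γ : Type*}
    {B : Set (E d)} (hB : MeasurableSet B) (c : SimpleFunc (E d) γ) (T : Finset γ) :
    iIndepFun (fun (e : T) ω => (window (fun i => ξ i ω) (B ∩ c ⁻¹' {(e : γ)})).card) P := by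
  classical
  have h := hP.indep_count T.card (fun k => B ∩ c ⁻¹' {(T.equivFin.symm k : γ)})
    (fun k => hB.inter (c.measurableSet_fiber _)) (by
      intro k l hkl
      refine Disjoint.mono Set.inter_subset_right Set.inter_subset_right ?_
      refine Disjoint.preimage _ ?_
      simpa [Subtype.ext_iff] using fun h => hkl (T.equivFin.symm.injective (Subtype.ext h)))
  have h2 := (h.precomp T.equivFin.injective).comp (fun _ => ENat.toNat)
    (fun _ => Measurable.of_discrete)
  convert h2 using 2 with e
  ext ω
  simp [card_window]

lemma setIntegral_comp_simpleFunc {γ : Type*} (c : SimpleFunc (E d) γ) {B : Set (E d)}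
    (hB : volume B ≠ ⊤) (f : γ → ℝ) :
    ∫ x in B, f (c x) = ∑ a ∈ c.range, volume.real (B ∩ c ⁻¹' {a}) * f a := by
  classical
  have : IsFiniteMeasure (volume.restrict B) := ⟨by simpa using hB.lt_top⟩
  have h1 : ∀ x, f (c x) = ∑ a ∈ c.range, (c ⁻¹' {a}).indicator (fun _ => f a) x := by
    intro x
    rw [Finset.sum_eq_single (c x)]
    · simp
    · intro b _ hb
      simp [Ne.symm hb]
    · intro h; exact absurd (c.mem_range_self x) h
  simp only [h1]
  rw [integral_finsetSum _ fun a _ => (integrable_const _).indicator (c.measurableSet_fiber a)]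
  refine Finset.sum_congr rfl fun a _ => ?_
  rw [integral_indicator_const _ (c.measurableSet_fiber a), smul_eq_mul, measureReal_restrict_apply
    (c.measurableSet_fiber a), Set.inter_comm]

/-- The expectation of a product of factorial-moment terms over the cells of a partition. -/
lemma IsPoissonProcess.integral_prod_descFactorial [IsProbabilityMeasure P]
    (hP : IsPoissonProcess P lam ξ) (hlam : 0 ≤ lam)
    {γ : Type*} {B : Set (E d)} (hB : MeasurableSet B) (hB' : volume B ≠ ⊤)
    (c : SimpleFunc (E d) γ) (m : γ → ℕ) (s : γ → ℝ) :
    ∫ ω, ∏ e ∈ c.range,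
      (((window (fun i => ξ i ω) (B ∩ c ⁻¹' {e})).card.descFactorial (m e) : ℝ) *
        s e ^ ((window (fun i => ξ i ω) (B ∩ c ⁻¹' {e})).card - m e)) ∂P
      = (∏ e ∈ c.range, (lam * volume.real (B ∩ c ⁻¹' {e})) ^ m e) *
        Real.exp (-lam * ∫ z in B, (1 - s (c z))) := by
  have hm : ∀ e, MeasurableSet (B ∩ c ⁻¹' {e}) := fun e => hB.inter (c.measurableSet_fiber _)
  have hf : ∀ e, volume (B ∩ c ⁻¹' {e}) ≠ ⊤ :=
    fun e => measure_ne_top_of_subset Set.inter_subset_left hB'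
  have h := (hP.iIndepFun_card hB c c.range).integral_fun_prod_comp
    (f := fun (e : c.range) (n : ℕ) => ((n.descFactorial (m e) : ℝ) * s e ^ (n - m e)))
    (fun e => (hP.hasLaw_card (hm e) (hf e)).aemeasurable)
    (fun e => Measurable.of_discrete.aestronglyMeasurable)
  have h2 : ∀ ω, ∏ e ∈ c.range,
      (((window (fun i => ξ i ω) (B ∩ c ⁻¹' {e})).card.descFactorial (m e) : ℝ) *
        s e ^ ((window (fun i => ξ i ω) (B ∩ c ⁻¹' {e})).card - m e)) = ∏ e : c.range,
      (((window (fun i => ξ i ω) (B ∩ c ⁻¹' {(e : γ)})).card.descFactorial (m e) : ℝ) *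
        s e ^ ((window (fun i => ξ i ω) (B ∩ c ⁻¹' {(e : γ)})).card - m e)) :=
    fun ω => (Finset.prod_coe_sort _ _).symm
  simp only [h2]
  rw [h]
  have h3 : ∀ e : c.range, ∫ ω,
      (((window (fun i => ξ i ω) (B ∩ c ⁻¹' {(e : γ)})).card.descFactorial (m e) : ℝ) *
        s e ^ ((window (fun i => ξ i ω) (B ∩ c ⁻¹' {(e : γ)})).card - m e)) ∂P
      = (fun e => (lam * volume.real (B ∩ c ⁻¹' {e})) ^ m e *
        Real.exp (-(lam * volume.real (B ∩ c ⁻¹' {e}) * (1 - s e)))) (e : γ) :=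
    fun e => hP.integral_descFactorial hlam (hm e) (hf e) _ _
  rw [Finset.prod_congr rfl fun e _ => h3 e,
    Finset.prod_coe_sort c.range (fun e => (lam * volume.real (B ∩ c ⁻¹' {e})) ^ m e *
        Real.exp (-(lam * volume.real (B ∩ c ⁻¹' {e}) * (1 - s e)))),
    Finset.prod_mul_distrib, ← Real.exp_sum, setIntegral_comp_simpleFunc c hB' (fun e => 1 - s e),
    Finset.mul_sum]
  congr 3
  ext e
  ring

lemma IsPoissonProcess.aestronglyMeasurable_prod_descFactorial [IsProbabilityMeasure P]
    (hP : IsPoissonProcess P lam ξ)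
    {γ : Type*} {B : Set (E d)} (hB : MeasurableSet B) (hB' : volume B ≠ ⊤)
    (c : SimpleFunc (E d) γ) (m : γ → ℕ) (s : γ → ℝ) :
    AEStronglyMeasurable (fun ω => ∏ e ∈ c.range,
      (((window (fun i => ξ i ω) (B ∩ c ⁻¹' {e})).card.descFactorial (m e) : ℝ) *
        s e ^ ((window (fun i => ξ i ω) (B ∩ c ⁻¹' {e})).card - m e))) P := by
  refine Finset.aestronglyMeasurable_fun_prod _ fun e _ => ?_
  have := (hP.hasLaw_card (hB.inter (c.measurableSet_fiber e))
    (measure_ne_top_of_subset Set.inter_subset_left hB')).aemeasurable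
  exact ((Measurable.of_discrete (f := fun n : ℕ => (n.descFactorial (m e) : ℝ) *
    s e ^ (n - m e))).comp_aemeasurable this).aestronglyMeasurable

/-- The square of the number of points is used as the common bound for sums over points and over
pairs; it is integrable for a Poisson process. -/
lemma abs_singleSum_le {γ : Type*} {S : Finset ℕ} {x : ℕ → γ} {G : γ → ℝ} {F : γ → γ → ℝ}
    (hG : ∀ a, |G a| ≤ 1) (hF : ∀ a b, F a b ∈ Set.Icc (0 : ℝ) 1) :
    |singleSum S x G F| ≤ (S.card : ℝ) ^ 2 := by
  refine (Finset.abs_sum_le_sum_abs _ _).trans ?_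
  have h : ∀ i ∈ S, |G (x i) * ∏ k ∈ S.erase i, F (x i) (x k)| ≤ 1 := by
    intro i _
    rw [abs_mul, abs_of_nonneg (Finset.prod_nonneg fun k _ => (hF _ _).1)]
    exact mul_le_one₀ (hG _) (Finset.prod_nonneg fun k _ => (hF _ _).1)
      (Finset.prod_le_one (fun k _ => (hF _ _).1) (fun k _ => (hF _ _).2))
  refine (Finset.sum_le_sum h).trans ?_
  simp only [Finset.sum_const, nsmul_eq_mul, mul_one]
  exact_mod_cast Nat.le_self_pow two_ne_zero _

lemma abs_pairSum_le {γ : Type*} {S : Finset ℕ} {x : ℕ → γ} {G : γ → γ → ℝ}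
    {F : γ → γ → γ → ℝ} (hG : ∀ a b, |G a b| ≤ 1) (hF : ∀ a b e, F a b e ∈ Set.Icc (0 : ℝ) 1) :
    |pairSum S x G F| ≤ (S.card : ℝ) ^ 2 := by
  refine (Finset.abs_sum_le_sum_abs _ _).trans ?_
  have h : ∀ i ∈ S, |∑ j ∈ S.erase i, G (x i) (x j) *
      ∏ k ∈ (S.erase i).erase j, F (x i) (x j) (x k)| ≤ S.card := by
    intro i _
    refine (Finset.abs_sum_le_sum_abs _ _).trans ?_
    have h2 : ∀ j ∈ S.erase i, |G (x i) (x j) *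
      ∏ k ∈ (S.erase i).erase j, F (x i) (x j) (x k)| ≤ 1 := by
      intro j _
      rw [abs_mul, abs_of_nonneg (Finset.prod_nonneg fun k _ => (hF _ _ _).1)]
      exact mul_le_one₀ (hG _ _) (Finset.prod_nonneg fun k _ => (hF _ _ _).1)
        (Finset.prod_le_one (fun k _ => (hF _ _ _).1) (fun k _ => (hF _ _ _).2))
    refine (Finset.sum_le_sum h2).trans ?_
    simp only [Finset.sum_const, nsmul_eq_mul, mul_one]
    exact_mod_cast Finset.card_erase_le
  refine (Finset.sum_le_sum h).trans ?_
  simp [sq]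

section Step

variable {γ : Type*} {B : Set (E d)}

lemma IsPoissonProcess.singleSum_simpleFunc_eq [DecidableEq γ] (hP : IsPoissonProcess P lam ξ)
    (hB : MeasurableSet B) (hB' : volume B ≠ ⊤) (c : SimpleFunc (E d) γ)
    (G : γ → ℝ) (F : γ → γ → ℝ) :
    ∀ᵐ ω ∂P, singleSum (window (fun i => ξ i ω) B) (fun i => c (ξ i ω)) G F
      = ∑ a ∈ c.range, G a * ∏ e ∈ c.range,
      (((window (fun i => ξ i ω) (B ∩ c ⁻¹' {e})).card.descFactorial (if e = a then 1 else 0) : ℝ) *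
        F a e ^ ((window (fun i => ξ i ω) (B ∩ c ⁻¹' {e})).card - (if e = a then 1 else 0))) := by
  filter_upwards [hP.ae_finite hB hB'] with ω hω
  rw [singleSum_eq _ c.range _ (fun i _ => c.mem_range_self _)]
  have (e : γ) : (window (fun i => ξ i ω) B).filter (fun k => c (ξ k ω) = e)
    = window (fun i => ξ i ω) (B ∩ c ⁻¹' {e}) := window_filter_eq hω c e
  simp only [this]

lemma IsPoissonProcess.pairSum_simpleFunc_eq [DecidableEq γ] (hP : IsPoissonProcess P lam ξ)
    (hB : MeasurableSet B) (hB' : volume B ≠ ⊤) (c : SimpleFunc (E d) γ)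
    (G : γ → γ → ℝ) (F : γ → γ → γ → ℝ) :
    ∀ᵐ ω ∂P, pairSum (window (fun i => ξ i ω) B) (fun i => c (ξ i ω)) G F
      = ∑ a ∈ c.range, ∑ b ∈ c.range, G a b * ∏ e ∈ c.range,
      (((window (fun i => ξ i ω) (B ∩ c ⁻¹' {e})).card.descFactorial (mult a b e) : ℝ) *
        F a b e ^ ((window (fun i => ξ i ω) (B ∩ c ⁻¹' {e})).card - mult a b e)) := by
  filter_upwards [hP.ae_finite hB hB'] with ω hω
  rw [pairSum_eq _ c.range _ (fun i _ => c.mem_range_self _)]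
  have (e : γ) : (window (fun i => ξ i ω) B).filter (fun k => c (ξ k ω) = e)
    = window (fun i => ξ i ω) (B ∩ c ⁻¹' {e}) := window_filter_eq hω c e
  simp only [this]

lemma IsPoissonProcess.aestronglyMeasurable_singleSum [IsProbabilityMeasure P]
    (hP : IsPoissonProcess P lam ξ)
    (hB : MeasurableSet B) (hB' : volume B ≠ ⊤) (c : SimpleFunc (E d) γ)
    (G : γ → ℝ) (F : γ → γ → ℝ) :
    AEStronglyMeasurable
      (fun ω => singleSum (window (fun i => ξ i ω) B) (fun i => c (ξ i ω)) G F) P := by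
  classical
  refine AEStronglyMeasurable.congr ?_ (EventuallyEq.symm (hP.singleSum_simpleFunc_eq hB hB' c G F))
  refine Finset.aestronglyMeasurable_fun_sum _ fun a _ => ?_
  exact (hP.aestronglyMeasurable_prod_descFactorial hB hB' c _ _).const_mul _

lemma IsPoissonProcess.aestronglyMeasurable_pairSum [IsProbabilityMeasure P]
    (hP : IsPoissonProcess P lam ξ)
    (hB : MeasurableSet B) (hB' : volume B ≠ ⊤) (c : SimpleFunc (E d) γ)
    (G : γ → γ → ℝ) (F : γ → γ → γ → ℝ) :
    AEStronglyMeasurable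
      (fun ω => pairSum (window (fun i => ξ i ω) B) (fun i => c (ξ i ω)) G F) P := by
  classical
  refine AEStronglyMeasurable.congr ?_ (EventuallyEq.symm (hP.pairSum_simpleFunc_eq hB hB' c G F))
  refine Finset.aestronglyMeasurable_fun_sum _ fun a _ =>
    Finset.aestronglyMeasurable_fun_sum _ fun b _ => ?_
  exact (hP.aestronglyMeasurable_prod_descFactorial hB hB' c _ _).const_mul _

/-- The one-point Mecke formula for functions that are constant on the cells of a finite
partition. -/
lemma IsPoissonProcess.integral_singleSum_simpleFunc [IsProbabilityMeasure P]
    (hP : IsPoissonProcess P lam ξ) (hlam : 0 ≤ lam)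
    (hB : MeasurableSet B) (hB' : volume B ≠ ⊤) (c : SimpleFunc (E d) γ)
    {G : γ → ℝ} {F : γ → γ → ℝ} (hF : ∀ a b, F a b ∈ Set.Icc (0 : ℝ) 1) :
    ∫ ω, singleSum (window (fun i => ξ i ω) B) (fun i => c (ξ i ω)) G F ∂P
      = lam * ∫ x in B, G (c x) * Real.exp (-lam * ∫ z in B, (1 - F (c x) (c z))) := by
  classical
  rw [integral_congr_ae (hP.singleSum_simpleFunc_eq hB hB' c G F), integral_finsetSum]
  · rw [setIntegral_comp_simpleFunc c hB'
      (fun a => G a * Real.exp (-lam * ∫ z in B, (1 - F a (c z)))), Finset.mul_sum]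
    refine Finset.sum_congr rfl fun a ha => ?_
    rw [integral_const_mul, hP.integral_prod_descFactorial hlam hB hB' c _ (F a),
      Finset.prod_eq_single a (fun e _ he => by simp [he]) (fun h => absurd ha h)]
    simp only [if_true, pow_one]
    ring
  · intro a ha
    refine Integrable.const_mul ?_ _
    refine (hP.integrable_card_sq hB hB').mono'
      (hP.aestronglyMeasurable_prod_descFactorial hB hB' c _ _) ?_
    -- each product is itself a `singleSum`, for the weight concentrated at `a`
    filter_upwards [hP.singleSum_simpleFunc_eq hB hB' c (fun a' => if a' = a then 1 else 0) F]
      with ω hω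
    rw [Finset.sum_eq_single a (fun b _ hb => by simp [hb]) (fun h => absurd ha h)] at hω
    simp only [if_true, one_mul] at hω
    rw [← hω, Real.norm_eq_abs]
    exact abs_singleSum_le (fun a' => by split_ifs <;> simp) hF

/-- The two-point Mecke formula for functions that are constant on the cells of a finite
partition. -/
lemma IsPoissonProcess.integral_pairSum_simpleFunc [IsProbabilityMeasure P]
    (hP : IsPoissonProcess P lam ξ) (hlam : 0 ≤ lam)
    (hB : MeasurableSet B) (hB' : volume B ≠ ⊤) (c : SimpleFunc (E d) γ)
    {G : γ → γ → ℝ} {F : γ → γ → γ → ℝ} (hF : ∀ a b e, F a b e ∈ Set.Icc (0 : ℝ) 1) :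
    ∫ ω, pairSum (window (fun i => ξ i ω) B) (fun i => c (ξ i ω)) G F ∂P
      = lam ^ 2 * ∫ x in B, ∫ y in B, G (c x) (c y) *
          Real.exp (-lam * ∫ z in B, (1 - F (c x) (c y) (c z))) := by
  classical
  have hint : ∀ a ∈ c.range, ∀ b ∈ c.range, Integrable (fun ω => G a b * ∏ e ∈ c.range,
      (((window (fun i => ξ i ω) (B ∩ c ⁻¹' {e})).card.descFactorial (mult a b e) : ℝ) *
        F a b e ^ ((window (fun i => ξ i ω) (B ∩ c ⁻¹' {e})).card - mult a b e))) P := by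
    intro a ha b hb
    refine Integrable.const_mul ?_ _
    refine (hP.integrable_card_sq hB hB').mono'
      (hP.aestronglyMeasurable_prod_descFactorial hB hB' c _ _) ?_
    -- each product is itself a `pairSum`, for the weight concentrated at `(a, b)`
    filter_upwards [hP.pairSum_simpleFunc_eq hB hB' c
      (fun a' b' => if a' = a ∧ b' = b then 1 else 0) F] with ω hω
    rw [Finset.sum_eq_single a (fun b _ hb => by simp [hb]) (fun h => absurd ha h),
      Finset.sum_eq_single b (fun b _ hb => by simp [hb]) (fun h => absurd hb h)] at hω
    simp only [and_self, if_true, one_mul] at hω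
    rw [← hω, Real.norm_eq_abs]
    exact abs_pairSum_le (fun a' b' => by split_ifs <;> simp) hF
  rw [integral_congr_ae (hP.pairSum_simpleFunc_eq hB hB' c G F), integral_finsetSum _
    fun a ha => integrable_finsetSum _ (hint a ha)]
  rw [setIntegral_comp_simpleFunc c hB' (fun a => ∫ y in B, G a (c y) *
          Real.exp (-lam * ∫ z in B, (1 - F a (c y) (c z)))), Finset.mul_sum]
  refine Finset.sum_congr rfl fun a ha => ?_
  rw [integral_finsetSum _ (hint a ha), setIntegral_comp_simpleFunc c hB' (fun b => G a b *
          Real.exp (-lam * ∫ z in B, (1 - F a b (c z)))), Finset.mul_sum, Finset.mul_sum]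
  refine Finset.sum_congr rfl fun b hb => ?_
  rw [integral_const_mul, hP.integral_prod_descFactorial hlam hB hB' c _ (F a b)]
  have : ∏ e ∈ c.range, (lam * volume.real (B ∩ c ⁻¹' {e})) ^ mult a b e
      = (lam * volume.real (B ∩ c ⁻¹' {a})) * (lam * volume.real (B ∩ c ⁻¹' {b})) := by
    simp only [mult, pow_add, Finset.prod_mul_distrib]
    congr 1
    · rw [Finset.prod_eq_single a (fun e _ he => by simp [he]) (fun h => absurd ha h)]; simp
    · rw [Finset.prod_eq_single b (fun e _ he => by simp [he]) (fun h => absurd hb h)]; simp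
  rw [this]
  ring

end Step

end RandomConnection

namespace RandomConnection

variable {d : ℕ} {Ω : Type*} [MeasurableSpace Ω] {P : Measure Ω} {lam : ℝ} {ξ : ℕ → Ω → E d}

/-! ### Null sets are avoided by single points and by pairs of points -/

lemma tsum_tsum_eq_sum_erase {S : Finset ℕ} {f : ℕ → ℕ → ENNReal}
    (h : ∀ i j, ¬ (i ∈ S ∧ j ∈ S ∧ i ≠ j) → f i j = 0) :
    ∑' i, ∑' j, f i j = ∑ i ∈ S, ∑ j ∈ S.erase i, f i j := by
  rw [tsum_eq_sum (s := S)]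
  · refine Finset.sum_congr rfl fun i hi => tsum_eq_sum fun j hj => h i j fun hh => hj ?_
    exact Finset.mem_erase.mpr ⟨Ne.symm hh.2.2, hh.2.1⟩
  · intro i hi
    simp [h i _ fun hh => hi hh.1]

/-- A property that holds for almost all `x` holds almost surely for all points of the process: a
null set contains a Poisson number of points with mean zero. -/
lemma IsPoissonProcess.ae_of_ae (hP : IsPoissonProcess P lam ξ) {p : E d → Prop}
    (hp : ∀ᵐ x, p x) : ∀ᵐ ω ∂P, ∀ i, p (ξ i ω) := by
  have hN : volume {x | ¬ p x} = 0 := hp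
  obtain ⟨A, hA, hAm, hA0⟩ := exists_measurable_superset_of_null hN
  have h := hP.hasLaw_card hAm (by simp [hA0])
  have h2 : ∀ᵐ ω ∂P, (window (fun i => ξ i ω) A).card = 0 := by
    rw [h.ae_iff (p := fun n => n = 0) Measurable.of_discrete, ae_iff_of_countable]
    intro n hn
    by_contra h0
    apply hn
    rw [poissonMeasure_singleton]
    simp [measureReal_def, hA0, h0]
  filter_upwards [h2, hP.ae_finite hAm (by simp [hA0])] with ω hω hfin i
  by_contra hi
  have : i ∈ window (fun i => ξ i ω) A := (mem_window hfin).mpr (hA hi)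
  rw [Finset.card_eq_zero.mp hω] at this
  simp at this

/-- The second factorial moment measure of a Poisson process, restricted to a product set. -/
lemma IsPoissonProcess.lintegral_pairs_prod [IsProbabilityMeasure P]
    (hP : IsPoissonProcess P lam ξ) (hlam : 0 ≤ lam) {B : Set (E d)}
    (hB : MeasurableSet B) (hB' : volume B ≠ ⊤) {A₁ A₂ : Set (E d)} (h₁ : MeasurableSet A₁)
    (h₂ : MeasurableSet A₂) :
    ∑' i, ∑' j, P {ω | i ≠ j ∧ ξ i ω ∈ B ∩ A₁ ∧ ξ j ω ∈ B ∩ A₂}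
      = ENNReal.ofReal (lam ^ 2) * volume (B ∩ A₁) * volume (B ∩ A₂) := by
  classical
  -- the cells are determined by membership in `A₁` and in `A₂`
  let c : SimpleFunc (E d) (Bool × Bool) :=
    (SimpleFunc.piecewise A₁ h₁ (SimpleFunc.const _ true) (SimpleFunc.const _ false)).pair
    (SimpleFunc.piecewise A₂ h₂ (SimpleFunc.const _ true) (SimpleFunc.const _ false))
  have hc1 : ∀ x, (c x).1 = true ↔ x ∈ A₁ := by
    intro x; by_cases hx : x ∈ A₁ <;> simp [c, hx]
  have hc2 : ∀ x, (c x).2 = true ↔ x ∈ A₂ := by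
    intro x; by_cases hx : x ∈ A₂ <;> simp [c, hx]
  let G : Bool × Bool → Bool × Bool → ℝ := fun a b => if a.1 = true ∧ b.2 = true then 1 else 0
  let F : Bool × Bool → Bool × Bool → Bool × Bool → ℝ := fun _ _ _ => 1
  have hF : ∀ a b e, F a b e ∈ Set.Icc (0 : ℝ) 1 := by simp [F]
  have hG : ∀ a b, |G a b| ≤ 1 := by intro a b; simp only [G]; split_ifs <;> simp
  have key := hP.integral_pairSum_simpleFunc hlam hB hB' c (G := G) hF
  have hmeas : ∀ i j, MeasurableSet {ω | i ≠ j ∧ ξ i ω ∈ B ∩ A₁ ∧ ξ j ω ∈ B ∩ A₂} := by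
    intro i j
    exact (MeasurableSet.const _).inter ((hP.measurable i (hB.inter h₁)).inter
      (hP.measurable j (hB.inter h₂)))
  have e1 : ∑' i, ∑' j, P {ω | i ≠ j ∧ ξ i ω ∈ B ∩ A₁ ∧ ξ j ω ∈ B ∩ A₂} =
      ∫⁻ ω, ∑' i, ∑' j,
        {ω | i ≠ j ∧ ξ i ω ∈ B ∩ A₁ ∧ ξ j ω ∈ B ∩ A₂}.indicator (fun _ => 1) ω ∂P := by
    rw [lintegral_tsum fun i => (Measurable.tsum fun j =>
      measurable_const.indicator (hmeas i j)).aemeasurable]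
    refine tsum_congr fun i => ?_
    rw [lintegral_tsum fun j => (measurable_const.indicator (hmeas i j)).aemeasurable]
    refine tsum_congr fun j => ?_
    rw [lintegral_indicator_const (hmeas i j), one_mul]
  have e2 : ∀ᵐ ω ∂P, ∑' i, ∑' j,
        {ω | i ≠ j ∧ ξ i ω ∈ B ∩ A₁ ∧ ξ j ω ∈ B ∩ A₂}.indicator (fun _ => (1 : ENNReal)) ω
      = ENNReal.ofReal (pairSum (window (fun i => ξ i ω) B) (fun i => c (ξ i ω)) G F) := by
    filter_upwards [hP.ae_finite hB hB'] with ω hω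
    rw [tsum_tsum_eq_sum_erase (S := window (fun i => ξ i ω) B)]
    · unfold pairSum
      rw [ENNReal.ofReal_sum_of_nonneg]
      · refine Finset.sum_congr rfl fun i hi => ?_
        rw [ENNReal.ofReal_sum_of_nonneg]
        · refine Finset.sum_congr rfl fun j hj => ?_
          have hi' := (mem_window hω).mp hi
          have hj' := (mem_window hω).mp (Finset.mem_of_mem_erase hj)
          have hij : i ≠ j := (Finset.ne_of_mem_erase hj).symm
          simp only [Set.indicator_apply, Set.mem_ofPred_eq, Set.mem_inter_iff, hi', hj', true_and,
            ne_eq, hij, not_false_eq_true, G, F, hc1, hc2, Finset.prod_const_one, mul_one]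
          split_ifs <;> simp
        · intro j _
          simp only [G, F, Finset.prod_const_one, mul_one]
          split_ifs <;> simp
      · intro i _
        refine Finset.sum_nonneg fun j _ => ?_
        simp only [G, F, Finset.prod_const_one, mul_one]
        split_ifs <;> simp
    · intro i j hij
      rw [Set.indicator_of_notMem]
      intro hmem
      exact hij ⟨(mem_window hω).mpr hmem.2.1.1, (mem_window hω).mpr hmem.2.2.1, hmem.1⟩
  have hint : Integrable
      (fun ω => pairSum (window (fun i => ξ i ω) B) (fun i => c (ξ i ω)) G F) P :=
    (hP.integrable_card_sq hB hB').mono' (hP.aestronglyMeasurable_pairSum hB hB' c G F)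
      (ae_of_all _ fun ω => abs_pairSum_le hG hF)
  have hnn : ∀ ω, 0 ≤ pairSum (window (fun i => ξ i ω) B) (fun i => c (ξ i ω)) G F := by
    intro ω
    refine Finset.sum_nonneg fun i _ => Finset.sum_nonneg fun j _ => ?_
    simp only [G, F, Finset.prod_const_one, mul_one]
    split_ifs <;> simp
  rw [e1, lintegral_congr_ae e2, ← ofReal_integral_eq_lintegral_ofReal hint (ae_of_all _ hnn), key]
  have e3 : ∀ x y, G (c x) (c y) * Real.exp (-lam * ∫ z in B, (1 - F (c x) (c y) (c z)))
      = A₁.indicator (fun _ => (1 : ℝ)) x * A₂.indicator (fun _ => (1 : ℝ)) y := by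
    intro x y
    simp only [G, F, hc1, hc2, Set.indicator_apply]
    by_cases hx : x ∈ A₁ <;> by_cases hy : y ∈ A₂ <;> simp [hx, hy]
  have f1 : volume (B ∩ A₁) ≠ ⊤ := measure_ne_top_of_subset Set.inter_subset_left hB'
  have f2 : volume (B ∩ A₂) ≠ ⊤ := measure_ne_top_of_subset Set.inter_subset_left hB'
  simp only [e3, integral_const_mul, integral_mul_const]
  rw [integral_indicator_const _ h₁, integral_indicator_const _ h₂, smul_eq_mul, smul_eq_mul,
    mul_one, mul_one, measureReal_restrict_apply h₁, measureReal_restrict_apply h₂,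
    ENNReal.ofReal_mul (by positivity), ENNReal.ofReal_mul (by positivity),
    Set.inter_comm A₁, Set.inter_comm A₂, ofReal_measureReal f1, ofReal_measureReal f2, mul_assoc]

/-- A property of pairs that holds for almost all `(x, y)` holds almost surely for all pairs of
points of the process with different indices. -/
lemma IsPoissonProcess.ae_pairs_of_ae [IsProbabilityMeasure P]
    (hP : IsPoissonProcess P lam ξ) (hlam : 0 ≤ lam) {B : Set (E d)}
    (hB : MeasurableSet B) (hB' : volume B ≠ ⊤) {p : E d × E d → Prop}
    (hp : ∀ᵐ q ∂(volume : Measure (E d)).prod volume, p q) :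
    ∀ᵐ ω ∂P, ∀ i j, i ≠ j → ξ i ω ∈ B → ξ j ω ∈ B → p (ξ i ω, ξ j ω) := by
  have hN : ((volume : Measure (E d)).prod volume) {x | ¬ p x} = 0 := hp
  obtain ⟨A, hA, hAm, hA0⟩ := exists_measurable_superset_of_null hN
  have hfin : IsFiniteMeasure (volume.restrict B) := ⟨by simpa using hB'.lt_top⟩
  -- the second factorial moment measure on `B × B`
  let α : Measure (E d × E d) := Measure.sum fun i => Measure.sum fun j =>
    (P.restrict {ω | i ≠ j ∧ ξ i ω ∈ B ∧ ξ j ω ∈ B}).map (fun ω => (ξ i ω, ξ j ω))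
  have hpair : ∀ i j, Measurable (fun ω => (ξ i ω, ξ j ω)) :=
    fun i j => (hP.measurable i).prodMk (hP.measurable j)
  have hα : ∀ A : Set (E d × E d), MeasurableSet A → α A =
      ∑' i, ∑' j, P {ω | (ξ i ω, ξ j ω) ∈ A ∧ i ≠ j ∧ ξ i ω ∈ B ∧ ξ j ω ∈ B} := by
    intro A hA
    simp only [α, Measure.sum_apply _ hA]
    refine tsum_congr fun i => tsum_congr fun j => ?_
    rw [Measure.map_apply (hpair i j) hA, Measure.restrict_apply (hpair i j hA)]
    rfl
  have hα2 : (ENNReal.ofReal (lam ^ 2) • volume.restrict B).prod (volume.restrict B) = α := by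
    have : IsFiniteMeasure (ENNReal.ofReal (lam ^ 2) • volume.restrict B) :=
      Measure.smul_finite _ ENNReal.ofReal_ne_top
    refine Measure.prod_eq fun s t hs ht => ?_
    rw [hα _ (hs.prod ht), Measure.smul_apply, smul_eq_mul, Measure.restrict_apply hs,
      Measure.restrict_apply ht, Set.inter_comm s, Set.inter_comm t,
      ← hP.lintegral_pairs_prod hlam hB hB' hs ht]
    refine tsum_congr fun i => tsum_congr fun j => congrArg P ?_
    ext ω
    simp only [Set.mem_ofPred_eq, Set.mem_prod, Set.mem_inter_iff]
    tauto
  have hαA : α A = 0 := by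
    rw [← hα2, Measure.prod_smul_left, Measure.smul_apply]
    have : ((volume.restrict B).prod (volume.restrict B)) A = 0 := by
      rw [Measure.prod_restrict]
      exact le_antisymm ((Measure.restrict_apply_le _ _).trans hA0.le) zero_le
    simp [this]
  rw [hα A hAm, ENNReal.tsum_eq_zero] at hαA
  rw [ae_all_iff]; intro i
  rw [ae_all_iff]; intro j
  have h0 := (ENNReal.tsum_eq_zero.mp (hαA i)) j
  have : ∀ᵐ ω ∂P, ¬ ((ξ i ω, ξ j ω) ∈ A ∧ i ≠ j ∧ ξ i ω ∈ B ∧ ξ j ω ∈ B) := by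
    rw [ae_iff]; simpa using h0
  filter_upwards [this] with ω hω hij hi hj
  by_contra hn
  exact hω ⟨hA hn, hij, hi, hj⟩

/-! ### Mecke formulas for almost everywhere continuous functions -/

/-- Simple functions converging pointwise to the identity of `ℝ^d`. -/
noncomputable def approxId (d n : ℕ) : SimpleFunc (E d) (E d) :=
  SimpleFunc.approxOn id measurable_id Set.univ 0 (Set.mem_univ _) n

lemma tendsto_approxId (x : E d) : Tendsto (fun n => approxId d n x) atTop (𝓝 x) := by
  have := SimpleFunc.tendsto_approxOn (f := (id : E d → E d)) measurable_id
    (s := Set.univ) (y₀ := 0) (Set.mem_univ _) (x := x) (by simp)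
  exact this

lemma tendsto_approxId_prod {f : E d → E d → ℝ} {x y : E d}
    (h : ContinuousAt (Function.uncurry f) (x, y)) :
    Tendsto (fun n => f (approxId d n x) (approxId d n y)) atTop (𝓝 (f x y)) :=
  h.tendsto.comp ((tendsto_approxId x).prodMk_nhds (tendsto_approxId y))

lemma SimpleFunc.aestronglyMeasurable_comp {α γ : Type*} [MeasurableSpace α] {μ : Measure α}
    (c : SimpleFunc α γ) (f : γ → ℝ) : AEStronglyMeasurable (fun x => f (c x)) μ :=
  (c.map f).stronglyMeasurable.aestronglyMeasurable

lemma exp_neg_integral_mem {B : Set (E d)} (hlam : 0 ≤ lam) {f : E d → ℝ}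
    (hf : ∀ z, f z ∈ Set.Icc (0 : ℝ) 1) :
    |Real.exp (-lam * ∫ z in B, (1 - f z))| ≤ 1 := by
  rw [abs_of_pos (Real.exp_pos _), Real.exp_le_one_iff]
  have : 0 ≤ ∫ z in B, (1 - f z) := integral_nonneg fun z => by
    have := (hf z).2; simp only [Pi.zero_apply]; linarith
  nlinarith

lemma tendsto_exp_integral {B : Set (E d)} (hB' : volume B ≠ ⊤) {f : ℕ → E d → ℝ} {g : E d → ℝ}
    (hm : ∀ n, AEStronglyMeasurable (f n) (volume.restrict B))
    (hf : ∀ n z, f n z ∈ Set.Icc (0 : ℝ) 1)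
    (h : ∀ᵐ z, Tendsto (fun n => f n z) atTop (𝓝 (g z))) :
    Tendsto (fun n => Real.exp (-lam * ∫ z in B, (1 - f n z))) atTop
      (𝓝 (Real.exp (-lam * ∫ z in B, (1 - g z)))) := by
  have hfin : IsFiniteMeasure (volume.restrict B) := ⟨by simpa using hB'.lt_top⟩
  refine (Real.continuous_exp.tendsto _).comp (Tendsto.const_mul _ ?_)
  refine tendsto_integral_of_dominated_convergence (fun _ => 1)
    (fun n => aestronglyMeasurable_const.sub (hm n)) (integrable_const _)
    (fun n => ae_of_all _ fun z => ?_) ?_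
  · have := hf n z
    rw [Real.norm_eq_abs, abs_le]; constructor <;> linarith [this.1, this.2]
  · filter_upwards [ae_restrict_of_ae h] with z hz
    exact hz.const_sub 1

/-- The one-point Mecke formula in a window, for almost everywhere continuous functions. -/
lemma IsPoissonProcess.integral_singleSum [IsProbabilityMeasure P]
    (hP : IsPoissonProcess P lam ξ) (hlam : 0 ≤ lam) {B : Set (E d)}
    (hB : MeasurableSet B) (hB' : volume B ≠ ⊤) {G : E d → ℝ} {f : E d → E d → ℝ}
    (hG : ∀ x, |G x| ≤ 1) (hf : ∀ x z, f x z ∈ Set.Icc (0 : ℝ) 1)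
    (hGc : ∀ᵐ x, ContinuousAt G x)
    (hfc : ∀ᵐ q ∂(volume : Measure (E d)).prod volume, ContinuousAt (Function.uncurry f) q) :
    Integrable (fun ω => singleSum (window (fun i => ξ i ω) B) (fun i => ξ i ω) G f) P ∧
    ∫ ω, singleSum (window (fun i => ξ i ω) B) (fun i => ξ i ω) G f ∂P
      = lam * ∫ x in B, G x * Real.exp (-lam * ∫ z in B, (1 - f x z)) := by
  have hfin : IsFiniteMeasure (volume.restrict B) := ⟨by simpa using hB'.lt_top⟩
  have hlim : ∀ᵐ ω ∂P, Tendsto (fun n => singleSum (window (fun i => ξ i ω) B)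
      (fun i => approxId d n (ξ i ω)) G f) atTop
      (𝓝 (singleSum (window (fun i => ξ i ω) B) (fun i => ξ i ω) G f)) := by
    filter_upwards [hP.ae_of_ae hGc, hP.ae_pairs_of_ae hlam hB hB' hfc] with ω h1 h2
    refine tendsto_finsetSum _ fun i hi => Tendsto.mul ?_ (tendsto_finsetProd _ fun k hk => ?_)
    · exact (h1 i).tendsto.comp (tendsto_approxId _)
    · exact tendsto_approxId_prod (h2 i k (Finset.ne_of_mem_erase hk).symm (mem_of_mem_window hi)
        (mem_of_mem_window (Finset.mem_of_mem_erase hk)))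
  have hmeas := fun n => hP.aestronglyMeasurable_singleSum hB hB' (approxId d n) G f
  refine ⟨(hP.integrable_card_sq hB hB').mono' (aestronglyMeasurable_of_tendsto_ae _ hmeas hlim)
    (ae_of_all _ fun ω => abs_singleSum_le hG hf), ?_⟩
  have t1 := tendsto_integral_of_dominated_convergence _ hmeas (hP.integrable_card_sq hB hB')
    (fun n => ae_of_all _ fun ω => abs_singleSum_le hG hf) hlim
  refine tendsto_nhds_unique t1 ?_
  simp only [hP.integral_singleSum_simpleFunc hlam hB hB' _ hf]
  refine Tendsto.const_mul _ (tendsto_integral_of_dominated_convergence (fun _ => 1)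
    (fun n => SimpleFunc.aestronglyMeasurable_comp (approxId d n)
      (fun a => G a * Real.exp (-lam * ∫ z in B, (1 - f a (approxId d n z)))))
    (integrable_const _) (fun n => ae_of_all _ fun x => ?_) (ae_restrict_of_ae ?_))
  · rw [Real.norm_eq_abs, abs_mul]
    exact mul_le_one₀ (hG _) (abs_nonneg _) (exp_neg_integral_mem hlam fun z => hf _ _)
  · filter_upwards [hGc, Measure.ae_ae_of_ae_prod hfc] with x hx hx2
    refine Tendsto.mul (hx.tendsto.comp (tendsto_approxId _)) (tendsto_exp_integral hB'
      (fun n => SimpleFunc.aestronglyMeasurable_comp (approxId d n) (f (approxId d n x)))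
      (fun n z => hf _ _) ?_)
    filter_upwards [hx2] with z hz using tendsto_approxId_prod hz

/-- The two-point Mecke formula in a window, for almost everywhere continuous functions. -/
lemma IsPoissonProcess.integral_pairSum [IsProbabilityMeasure P]
    (hP : IsPoissonProcess P lam ξ) (hlam : 0 ≤ lam) {B : Set (E d)}
    (hB : MeasurableSet B) (hB' : volume B ≠ ⊤) {G f₁ f₂ : E d → E d → ℝ}
    (hG : ∀ x y, |G x y| ≤ 1) (hf₁ : ∀ x z, f₁ x z ∈ Set.Icc (0 : ℝ) 1)
    (hf₂ : ∀ x z, f₂ x z ∈ Set.Icc (0 : ℝ) 1)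
    (hGc : ∀ᵐ q ∂(volume : Measure (E d)).prod volume, ContinuousAt (Function.uncurry G) q)
    (hfc₁ : ∀ᵐ q ∂(volume : Measure (E d)).prod volume, ContinuousAt (Function.uncurry f₁) q)
    (hfc₂ : ∀ᵐ q ∂(volume : Measure (E d)).prod volume, ContinuousAt (Function.uncurry f₂) q) :
    Integrable (fun ω => pairSum (window (fun i => ξ i ω) B) (fun i => ξ i ω) G
        (fun x y z => f₁ x z * f₂ y z)) P ∧
    ∫ ω, pairSum (window (fun i => ξ i ω) B) (fun i => ξ i ω) G
        (fun x y z => f₁ x z * f₂ y z) ∂P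
      = lam ^ 2 * ∫ x in B, ∫ y in B,
          G x y * Real.exp (-lam * ∫ z in B, (1 - f₁ x z * f₂ y z)) := by
  have hfin : IsFiniteMeasure (volume.restrict B) := ⟨by simpa using hB'.lt_top⟩
  have hF : ∀ x y z, f₁ x z * f₂ y z ∈ Set.Icc (0 : ℝ) 1 := fun x y z =>
    ⟨mul_nonneg (hf₁ x z).1 (hf₂ y z).1,
      mul_le_one₀ (hf₁ x z).2 (hf₂ y z).1 (hf₂ y z).2⟩
  have hlim : ∀ᵐ ω ∂P, Tendsto (fun n => pairSum (window (fun i => ξ i ω) B)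
      (fun i => approxId d n (ξ i ω)) G (fun x y z => f₁ x z * f₂ y z)) atTop
      (𝓝 (pairSum (window (fun i => ξ i ω) B) (fun i => ξ i ω) G
        (fun x y z => f₁ x z * f₂ y z))) := by
    filter_upwards [hP.ae_pairs_of_ae hlam hB hB' hGc, hP.ae_pairs_of_ae hlam hB hB' hfc₁,
      hP.ae_pairs_of_ae hlam hB hB' hfc₂] with ω h0 h1 h2
    refine tendsto_finsetSum _ fun i hi => tendsto_finsetSum _ fun j hj =>
      Tendsto.mul ?_ (tendsto_finsetProd _ fun k hk => Tendsto.mul ?_ ?_)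
    all_goals
      have hj' := Finset.mem_erase.mp hj
    · exact tendsto_approxId_prod (h0 i j hj'.1.symm (mem_of_mem_window hi)
        (mem_of_mem_window hj'.2))
    · have hk' := Finset.mem_erase.mp (Finset.mem_of_mem_erase hk)
      exact tendsto_approxId_prod (h1 i k hk'.1.symm (mem_of_mem_window hi)
        (mem_of_mem_window hk'.2))
    · have hk' := Finset.mem_erase.mp (Finset.mem_of_mem_erase hk)
      exact tendsto_approxId_prod (h2 j k (Finset.ne_of_mem_erase hk).symm
        (mem_of_mem_window hj'.2) (mem_of_mem_window hk'.2))
  have hmeas := fun n => hP.aestronglyMeasurable_pairSum hB hB' (approxId d n) G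
    (fun x y z => f₁ x z * f₂ y z)
  refine ⟨(hP.integrable_card_sq hB hB').mono' (aestronglyMeasurable_of_tendsto_ae _ hmeas hlim)
    (ae_of_all _ fun ω => abs_pairSum_le hG hF), ?_⟩
  have t1 := tendsto_integral_of_dominated_convergence _ hmeas (hP.integrable_card_sq hB hB')
    (fun n => ae_of_all _ fun ω => abs_pairSum_le hG hF) hlim
  refine tendsto_nhds_unique t1 ?_
  simp only [hP.integral_pairSum_simpleFunc hlam hB hB' _ hF]
  have hb : ∀ n x y, ‖G (approxId d n x) (approxId d n y) * Real.exp (-lam * ∫ z in B,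
      (1 - f₁ (approxId d n x) (approxId d n z) * f₂ (approxId d n y) (approxId d n z)))‖ ≤ 1 := by
    intro n x y
    rw [Real.norm_eq_abs, abs_mul]
    exact mul_le_one₀ (hG _ _) (abs_nonneg _) (exp_neg_integral_mem hlam fun z => hF _ _ _)
  refine Tendsto.const_mul _ (tendsto_integral_of_dominated_convergence
    (fun _ => volume.real B)
    (fun n => SimpleFunc.aestronglyMeasurable_comp (approxId d n)
      (fun a => ∫ y in B, G a (approxId d n y) * Real.exp (-lam * ∫ z in B,
        (1 - f₁ a (approxId d n z) * f₂ (approxId d n y) (approxId d n z)))))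
    (integrable_const _) (fun n => ae_of_all _ fun x => ?_) (ae_restrict_of_ae ?_))
  · refine (norm_integral_le_of_norm_le_const (ae_of_all _ fun y => hb n x y)).trans ?_
    simp
  · filter_upwards [Measure.ae_ae_of_ae_prod hGc, Measure.ae_ae_of_ae_prod hfc₁] with x hx hx1
    refine tendsto_integral_of_dominated_convergence (fun _ => 1)
      (fun n => SimpleFunc.aestronglyMeasurable_comp (approxId d n)
        (fun b => G (approxId d n x) b * Real.exp (-lam * ∫ z in B,
        (1 - f₁ (approxId d n x) (approxId d n z) * f₂ b (approxId d n z)))))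
      (integrable_const _) (fun n => ae_of_all _ fun y => hb n x y) (ae_restrict_of_ae ?_)
    filter_upwards [hx, Measure.ae_ae_of_ae_prod hfc₂] with y hy hy2
    refine Tendsto.mul (tendsto_approxId_prod hy) (tendsto_exp_integral hB'
      (fun n => SimpleFunc.aestronglyMeasurable_comp (approxId d n)
        (fun e => f₁ (approxId d n x) e * f₂ (approxId d n y) e))
      (fun n z => hF _ _ _) ?_)
    filter_upwards [hx1, hy2] with z hz hz2
    exact (tendsto_approxId_prod hz).mul (tendsto_approxId_prod hz2)

end RandomConnection

namespace RandomConnection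

variable {d : ℕ} {Ω : Type*} [MeasurableSpace Ω] {P : Measure Ω} {lam : ℝ} {ξ : ℕ → Ω → E d}
  {u : Sym2 ℕ → Ω → ℝ}

/-! ### Profiles -/

/-- A non-increasing function `h : [0,∞) → [0,1]` such that `h(|·|)` is integrable on `ℝ^d`; unlike
for a connection function, the integral may vanish. -/
structure IsProfile (d : ℕ) (h : ℝ → ℝ) : Prop where
  mem_Icc : ∀ r, 0 ≤ r → h r ∈ Set.Icc (0 : ℝ) 1
  antitoneOn : AntitoneOn h (Set.Ici 0)
  integrable : Integrable (fun y : E d => h ‖y‖) volume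

namespace IsProfile

variable {h : ℝ → ℝ}

lemma nonneg (hh : IsProfile d h) (y : E d) : 0 ≤ h ‖y‖ := (hh.mem_Icc _ (norm_nonneg y)).1

lemma le_one (hh : IsProfile d h) (y : E d) : h ‖y‖ ≤ 1 := (hh.mem_Icc _ (norm_nonneg y)).2

/-- The extension of `h` to the negative half-line by the constant `h 0` is antitone. -/
lemma antitone_max (hh : IsProfile d h) : Antitone (fun r => h (max r 0)) := fun _ _ hab =>
  hh.antitoneOn (Set.mem_Ici.mpr (le_max_right _ _)) (Set.mem_Ici.mpr (le_max_right _ _))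
     (max_le_max_right 0 hab)

lemma measurable_norm (hh : IsProfile d h) : Measurable (fun y : E d => h ‖y‖) := by
  have : (fun y : E d => h ‖y‖) = (fun r => h (max r 0)) ∘ norm := by
    ext y; simp
  rw [this]
  exact hh.antitone_max.measurable.comp _root_.measurable_norm

lemma measurable_sub (hh : IsProfile d h) :
    Measurable (fun q : E d × E d => h ‖q.1 - q.2‖) :=
  hh.measurable_norm.comp (measurable_fst.sub measurable_snd)

lemma sub_mem_Icc (hh : IsProfile d h) (x y : E d) : 1 - h ‖x - y‖ ∈ Set.Icc (0 : ℝ) 1 :=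
  ⟨by linarith [hh.le_one (x - y)], by linarith [hh.nonneg (x - y)]⟩

/-- The radial function `(x, y) ↦ h(|x - y|)` is continuous almost everywhere: its points of
discontinuity lie on countably many spheres around `x`. -/
lemma ae_continuousAt (hd : 1 ≤ d) (hh : IsProfile d h) :
    ∀ᵐ q ∂(volume : Measure (E d)).prod volume,
      ContinuousAt (Function.uncurry fun x y : E d => 1 - h ‖x - y‖) q := by
  have : Nontrivial (E d) := by
    have : Nonempty (Fin d) := ⟨⟨0, hd⟩⟩
    infer_instance
  set D : Set ℝ := {r | ¬ ContinuousAt (fun r => h (max r 0)) r} with hD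
  have hDc : D.Countable := hh.antitone_max.countable_not_continuousAt
  have hmeas : MeasurableSet {q : E d × E d | ‖q.1 - q.2‖ ∈ D} :=
    (measurable_fst.sub measurable_snd).norm hDc.measurableSet
  have h0 : ((volume : Measure (E d)).prod volume) {q : E d × E d | ‖q.1 - q.2‖ ∈ D} = 0 := by
    rw [Measure.measure_prod_null hmeas]
    refine ae_of_all _ fun x => ?_
    have : Prod.mk x ⁻¹' {q : E d × E d | ‖q.1 - q.2‖ ∈ D} = ⋃ r ∈ D, Metric.sphere x r := by
      ext y; simp [norm_sub_rev]
    simp only [this, Pi.zero_apply]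
    exact (measure_biUnion_null_iff hDc).mpr fun r _ => Measure.addHaar_sphere _ _ _
  have h1 : ∀ᵐ q ∂(volume : Measure (E d)).prod volume, ¬ ‖q.1 - q.2‖ ∈ D := by
    rw [ae_iff]; simpa using h0
  filter_upwards [h1] with q hq
  have hq' : ContinuousAt (fun r => h (max r 0)) ‖q.1 - q.2‖ := by
    simpa [hD] using hq
  have h2 : ContinuousAt (fun q : E d × E d => ‖q.1 - q.2‖) q := by fun_prop
  have h3 : ContinuousAt (fun q : E d × E d => h (max ‖q.1 - q.2‖ 0)) q :=
    ContinuousAt.comp (f := fun q : E d × E d => ‖q.1 - q.2‖) hq' h2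
  have h4 : (Function.uncurry fun x y : E d => 1 - h ‖x - y‖) =
      fun q : E d × E d => 1 - h (max ‖q.1 - q.2‖ 0) := by
    ext q; simp [Function.uncurry]
  rw [h4]
  exact continuousAt_const.sub h3

end IsProfile

/-! ### Integrating out the marks -/

/-- Given the points, events on points and marks are evaluated by integrating over an independent
copy of the marks. -/
lemma IsMarkedPoissonProcess.measure_eq_lintegral [IsProbabilityMeasure P]
    (hX : IsMarkedPoissonProcess P lam ξ u) {A : Set ((ℕ → E d) × (Sym2 ℕ → ℝ))}
    (hA : MeasurableSet A) :
    P {ω | ((fun i => ξ i ω), (fun e => u e ω)) ∈ A}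
      = ∫⁻ ω, P {ω' | ((fun i => ξ i ω), (fun e => u e ω')) ∈ A} ∂P := by
  have m1 : Measurable (fun ω i => ξ i ω) := measurable_pi_lambda _ hX.poisson.measurable
  have m2 : Measurable (fun ω e => u e ω) := measurable_pi_lambda _ hX.measurable_mark
  have h := (indepFun_iff_map_prod_eq_prod_map_map m1.aemeasurable m2.aemeasurable).mp
    hX.indep_points_marks
  have h1 : P {ω | ((fun i => ξ i ω), (fun e => u e ω)) ∈ A}
      = P.map (fun ω => ((fun i => ξ i ω), (fun e => u e ω))) A := by
    rw [Measure.map_apply (m1.prodMk m2) hA]; rfl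
  have : IsProbabilityMeasure (P.map fun ω e => u e ω) :=
    Measure.isProbabilityMeasure_map m2.aemeasurable
  rw [h1, h, Measure.prod_apply hA, lintegral_map (measurable_measure_prodMk_left hA) m1]
  refine lintegral_congr fun ω => ?_
  rw [Measure.map_apply m2 (measurable_prodMk_left hA)]
  rfl

lemma IsMarkedPoissonProcess.measure_le_mark
    (hX : IsMarkedPoissonProcess P lam ξ u) (e : Sym2 ℕ) {a : ℝ} (ha : a ∈ Set.Icc (0 : ℝ) 1) :
    P {ω | a ≤ u e ω} = ENNReal.ofReal (1 - a) := by
  have h := (hX.hasLaw_mark e).measure_eq (p := fun v => a ≤ v) measurableSet_Ici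
  rw [h, Measure.restrict_apply (show MeasurableSet {x : ℝ | a ≤ x} from measurableSet_Ici)]
  have : {x | a ≤ x} ∩ Set.Icc 0 1 = Set.Icc a 1 := by
    ext x
    simp only [Set.mem_inter_iff, Set.mem_ofPred_eq, Set.mem_Icc]
    constructor
    · rintro ⟨h1, h2, h3⟩; exact ⟨h1, h3⟩
    · rintro ⟨h1, h2⟩; exact ⟨h1, ha.1.trans h1, h2⟩
  rw [this, Real.volume_Icc]

/-- The marks of the pairs `e t` exceed the thresholds `a t` independently of each other. -/
lemma IsMarkedPoissonProcess.measure_forall_le_mark [IsProbabilityMeasure P]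
    (hX : IsMarkedPoissonProcess P lam ξ u) {ι : Type*} (T : Finset ι) (e : ι → Sym2 ℕ)
    (he : Set.InjOn e T) (a : ι → ℝ) (ha : ∀ t, a t ∈ Set.Icc (0 : ℝ) 1) :
    P {ω | ∀ t ∈ T, a t ≤ u (e t) ω} = ENNReal.ofReal (∏ t ∈ T, (1 - a t)) := by
  have hinj : Function.Injective (fun t : T => e t) := fun s t hst =>
    Subtype.ext (he s.2 t.2 hst)
  have h := (hX.indep_mark.precomp hinj).measure_inter_preimage_eq_mul Finset.univ
    (sets := fun t => Set.Ici (a t)) (fun _ _ => measurableSet_Ici)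
  have h1 : {ω | ∀ t ∈ T, a t ≤ u (e t) ω} =
      ⋂ t ∈ (Finset.univ : Finset T), u (e t) ⁻¹' Set.Ici (a t) := by
    ext ω; simp
  rw [h1, h, ENNReal.ofReal_prod_of_nonneg fun t _ => by linarith [(ha t).2],
    ← Finset.prod_coe_sort T (fun t => ENNReal.ofReal (1 - a t))]
  refine Finset.prod_congr rfl fun t _ => ?_
  exact hX.measure_le_mark (e t) (ha t)

/-- The point `i` has no neighbour among the points in `B`, for the connection function `h`. -/
def IsolatedIn (h : ℝ → ℝ) (B : Set (E d)) (x : ℕ → E d) (v : Sym2 ℕ → ℝ) (i : ℕ) : Prop :=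
  ∀ k, k ≠ i → x k ∈ B → h ‖x i - x k‖ ≤ v s(i, k)

lemma isolatedIn_univ {h : ℝ → ℝ} {x : ℕ → E d} {v : Sym2 ℕ → ℝ} {i : ℕ} :
    IsolatedIn h Set.univ x v i ↔ (graph h x v).IsIsolated i := by
  simp only [IsolatedIn, SimpleGraph.IsIsolated, graph, Set.mem_univ, true_imp_iff, not_and, not_lt]
  exact forall_congr' fun k => by rw [ne_comm]

lemma measurableSet_isolatedIn {h : ℝ → ℝ} (hh : IsProfile d h) {B : Set (E d)}
    (hB : MeasurableSet B) (i : ℕ) :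
    MeasurableSet {q : (ℕ → E d) × (Sym2 ℕ → ℝ) | IsolatedIn h B q.1 q.2 i} := by
  have : {q : (ℕ → E d) × (Sym2 ℕ → ℝ) | IsolatedIn h B q.1 q.2 i} =
      ⋂ k, ⋂ (_ : k ≠ i), {q : (ℕ → E d) × (Sym2 ℕ → ℝ) | q.1 k ∈ B}ᶜ ∪
        {q | h ‖q.1 i - q.1 k‖ ≤ q.2 s(i, k)} := by
    ext q
    simp [IsolatedIn, imp_iff_not_or]
  rw [this]
  refine MeasurableSet.iInter fun k => MeasurableSet.iInter fun _ =>
    (MeasurableSet.compl ?_).union ?_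
  · exact hB.preimage ((measurable_pi_apply k).comp measurable_fst)
  · refine measurableSet_le ?_ ((measurable_pi_apply _).comp measurable_snd)
    exact hh.measurable_norm.comp (((measurable_pi_apply i).comp measurable_fst).sub
      ((measurable_pi_apply k).comp measurable_fst))

lemma IsMarkedPoissonProcess.measure_isolatedIn [IsProbabilityMeasure P]
    (hX : IsMarkedPoissonProcess P lam ξ u) {h : ℝ → ℝ} (hh : IsProfile d h) {B : Set (E d)}
    {x : ℕ → E d} (hfin : {i | x i ∈ B}.Finite) (i : ℕ) :
    P {ω | IsolatedIn h B x (fun e => u e ω) i}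
      = ENNReal.ofReal (∏ k ∈ (window x B).erase i, (1 - h ‖x i - x k‖)) := by
  rw [← hX.measure_forall_le_mark _ (fun k => s(i, k)) (fun k _ l _ hkl => by
      have : k = l ∨ i = l ∧ k = i := by simpa using hkl
      lia) _
    (fun k => hh.mem_Icc _ (norm_nonneg _))]
  congr 1
  ext ω
  simp only [IsolatedIn, Set.mem_ofPred_eq, Finset.mem_erase, mem_window hfin, and_imp]

/-- Given the points, the probability that `i` is isolated for `h` and `j` for the larger function
`h'`: all marks involved are different, apart from the mark of the pair `i, j`, for which the
larger threshold counts. -/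
lemma IsMarkedPoissonProcess.measure_isolatedIn_and [IsProbabilityMeasure P]
    (hX : IsMarkedPoissonProcess P lam ξ u) {h h' : ℝ → ℝ} (hh : IsProfile d h)
    (hh' : IsProfile d h') (hle : ∀ r, 0 ≤ r → h r ≤ h' r) {B : Set (E d)}
    {x : ℕ → E d} (hfin : {i | x i ∈ B}.Finite) {i j : ℕ} (hij : i ≠ j) (hi : x i ∈ B)
    (hj : x j ∈ B) :
    P {ω | IsolatedIn h B x (fun e => u e ω) i ∧ IsolatedIn h' B x (fun e => u e ω) j}
      = ENNReal.ofReal ((1 - h' ‖x i - x j‖) * ∏ k ∈ ((window x B).erase i).erase j,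
          (1 - h ‖x i - x k‖) * (1 - h' ‖x j - x k‖)) := by
  set S := window x B with hS
  -- the pairs `i, k` and the pairs `j, k`, where the pair `i, j` is listed with the former only
  let T : Finset (ℕ ⊕ ℕ) := (S.erase i).disjSum ((S.erase i).erase j)
  let e : ℕ ⊕ ℕ → Sym2 ℕ := Sum.elim (fun k => s(i, k)) (fun k => s(j, k))
  let a : ℕ ⊕ ℕ → ℝ := Sum.elim (fun k => if k = j then h' ‖x i - x j‖ else h ‖x i - x k‖)
    (fun k => h' ‖x j - x k‖)
  have he : Set.InjOn e T := by
    rintro (k | k) hk (l | l) hl hkl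
    · have : k = l ∨ i = l ∧ k = i := by simpa [e] using hkl
      exact congrArg _ (by lia)
    · simp only [T, Finset.mem_coe, Finset.inl_mem_disjSum, Finset.inr_mem_disjSum,
        Finset.mem_erase] at hk hl
      simp only [e, Sum.elim_inl, Sum.elim_inr, Sym2.eq_iff] at hkl
      exact absurd hkl (by rintro (⟨h1, _⟩ | ⟨h1, _⟩); exacts [hij h1, hl.2.1 h1.symm])
    · simp only [T, Finset.mem_coe, Finset.inl_mem_disjSum, Finset.inr_mem_disjSum,
        Finset.mem_erase] at hk hl
      simp only [e, Sum.elim_inl, Sum.elim_inr, Sym2.eq_iff] at hkl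
      exact absurd hkl (by rintro (⟨h1, _⟩ | ⟨_, h1⟩); exacts [hij h1.symm, hk.2.1 h1])
    · have : k = l ∨ j = l ∧ k = j := by simpa [e] using hkl
      exact congrArg _ (by lia)
  have ha : ∀ t, a t ∈ Set.Icc (0 : ℝ) 1 := by
    rintro (k | k)
    · simp only [a, Sum.elim_inl]
      split_ifs
      exacts [hh'.mem_Icc _ (norm_nonneg _), hh.mem_Icc _ (norm_nonneg _)]
    · exact hh'.mem_Icc _ (norm_nonneg _)
  have hjS : j ∈ S.erase i := Finset.mem_erase.mpr ⟨hij.symm, (mem_window hfin).mpr hj⟩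
  have hprod : ∏ t ∈ T, (1 - a t) = (1 - h' ‖x i - x j‖) * ∏ k ∈ (S.erase i).erase j,
          (1 - h ‖x i - x k‖) * (1 - h' ‖x j - x k‖) := by
    rw [Finset.prod_disjSum, ← Finset.mul_prod_erase _ _ hjS, Finset.prod_mul_distrib, ← mul_assoc]
    simp only [a, Sum.elim_inl, Sum.elim_inr, if_true]
    congr 2
    refine Finset.prod_congr rfl fun k hk => ?_
    rw [if_neg (Finset.ne_of_mem_erase hk)]
  rw [← hprod, ← hX.measure_forall_le_mark T e he a ha]
  congr 1
  ext ω
  simp only [IsolatedIn, Set.mem_ofPred_eq, T, Sum.forall, Finset.inl_mem_disjSum,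
    Finset.inr_mem_disjSum, Finset.mem_erase, hS, mem_window hfin, a, e, Sum.elim_inl,
    Sum.elim_inr, and_imp]
  constructor
  · rintro ⟨h1, h2⟩
    refine ⟨fun k hki hk => ?_, fun k hkj _ hk => h2 k hkj hk⟩
    split_ifs with hkj
    · subst hkj
      have := h2 i hij hi
      rwa [norm_sub_rev, Sym2.eq_swap] at this
    · exact h1 k hki hk
  · rintro ⟨h1, h2⟩
    refine ⟨fun k hki hk => ?_, fun k hkj hk => ?_⟩
    · have := h1 k hki hk
      split_ifs at this with hkj
      · subst hkj
        exact (hle _ (norm_nonneg _)).trans this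
      · exact this
    · by_cases hki : k = i
      · subst hki
        have := h1 j hij.symm hj
        rw [if_pos rfl] at this
        rwa [norm_sub_rev, Sym2.eq_swap]
      · exact h2 k hkj hki hk

end RandomConnection

namespace RandomConnection

variable {d : ℕ} {Ω : Type*} [MeasurableSpace Ω] {P : Measure Ω} {lam : ℝ} {ξ : ℕ → Ω → E d}
  {u : Sym2 ℕ → Ω → ℝ}

/-! ### Moments of the numbers of isolated vertices in a window -/

/-- If a nonnegative random variable `X` is a countable sum of indicators of events on points and
marks, and `Z` is the sum of their conditional probabilities given the points, then `X` and `Z`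
have the same expectation. -/
lemma IsMarkedPoissonProcess.integral_eq_of_tsum [IsProbabilityMeasure P]
    (hX : IsMarkedPoissonProcess P lam ξ u) {ι : Type*} [Countable ι]
    {A : ι → Set ((ℕ → E d) × (Sym2 ℕ → ℝ))} (hA : ∀ t, MeasurableSet (A t)) {X Z : Ω → ℝ}
    (hX0 : ∀ ω, 0 ≤ X ω) (hZ0 : ∀ ω, 0 ≤ Z ω) (hZ : Integrable Z P)
    (h1 : ∀ᵐ ω ∂P, ∑' t, (A t).indicator (fun _ => (1 : ENNReal))
      ((fun i => ξ i ω), (fun e => u e ω)) = ENNReal.ofReal (X ω))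
    (h2 : ∀ᵐ ω ∂P, ∑' t, P {ω' | ((fun i => ξ i ω), (fun e => u e ω')) ∈ A t}
      = ENNReal.ofReal (Z ω)) :
    AEStronglyMeasurable X P ∧ ∫ ω, X ω ∂P = ∫ ω, Z ω ∂P := by
  have m1 : Measurable (fun ω i => ξ i ω) := measurable_pi_lambda _ hX.poisson.measurable
  have m2 : Measurable (fun ω e => u e ω) := measurable_pi_lambda _ hX.measurable_mark
  have hind : ∀ t, Measurable (fun ω => (A t).indicator (fun _ => (1 : ENNReal))
      ((fun i => ξ i ω), (fun e => u e ω))) :=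
    fun t => (measurable_const.indicator (hA t)).comp (m1.prodMk m2)
  have hmeas : AEStronglyMeasurable X P := by
    have : Measurable (fun ω => (∑' t, (A t).indicator (fun _ => (1 : ENNReal))
      ((fun i => ξ i ω), (fun e => u e ω))).toReal) := (Measurable.tsum hind).ennreal_toReal
    refine this.aestronglyMeasurable.congr ?_
    filter_upwards [h1] with ω hω
    rw [hω, ENNReal.toReal_ofReal (hX0 ω)]
  refine ⟨hmeas, ?_⟩
  rw [integral_eq_lintegral_of_nonneg_ae (ae_of_all _ hX0) hmeas,
    integral_eq_lintegral_of_nonneg_ae (ae_of_all _ hZ0) hZ.aestronglyMeasurable,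
    ← lintegral_congr_ae h1, ← lintegral_congr_ae h2, lintegral_tsum fun t => (hind t).aemeasurable,
    lintegral_tsum]
  · congr 1
    refine tsum_congr fun t => ?_
    rw [← hX.measure_eq_lintegral (hA t)]
    have : (fun ω => (A t).indicator (fun _ => (1 : ENNReal))
      ((fun i => ξ i ω), (fun e => u e ω))) =
      {ω | ((fun i => ξ i ω), (fun e => u e ω)) ∈ A t}.indicator (fun _ => 1) := rfl
    exact (congrArg (lintegral P) this).trans
      ((lintegral_indicator_const (s := {ω | ((fun i => ξ i ω), (fun e => u e ω)) ∈ A t})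
        (m1.prodMk m2 (hA t)) 1).trans (one_mul _))
  · intro t
    have m3 := measurable_measure_prodMk_left (ν := P.map fun ω e => u e ω) (hA t)
    refine Measurable.aemeasurable ?_
    convert m3.comp m1 using 2 with ω
    simp only [Function.comp]
    rw [Measure.map_apply m2 (measurable_prodMk_left (hA t))]
    rfl

open Classical in
/-- The indicator of the event that `i` has no neighbour in `B`. -/
noncomputable def isoInd (h : ℝ → ℝ) (B : Set (E d)) (x : ℕ → E d) (v : Sym2 ℕ → ℝ) (i : ℕ) : ℝ :=
  if IsolatedIn h B x v i then 1 else 0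

/-- The number of vertices in `K` without neighbours in `B`. -/
noncomputable def isoCount (h : ℝ → ℝ) (B K : Set (E d)) (x : ℕ → E d) (v : Sym2 ℕ → ℝ) : ℝ :=
  ∑ i ∈ window x K, isoInd h B x v i

/-- The number of ordered pairs of different vertices in `K`, the first without neighbours in `B`
for `h` and the second for `h'`. -/
noncomputable def isoPairs (h h' : ℝ → ℝ) (B K : Set (E d)) (x : ℕ → E d) (v : Sym2 ℕ → ℝ) : ℝ :=
  ∑ i ∈ window x K, ∑ j ∈ (window x K).erase i, isoInd h B x v i * isoInd h' B x v j

section Bounds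

variable {h h' : ℝ → ℝ} {B K : Set (E d)} {x : ℕ → E d} {v : Sym2 ℕ → ℝ}

lemma isoInd_mem (i : ℕ) : isoInd h B x v i ∈ Set.Icc (0 : ℝ) 1 := by
  unfold isoInd; split_ifs <;> simp

lemma isoCount_nonneg : 0 ≤ isoCount h B K x v :=
  Finset.sum_nonneg fun i _ => (isoInd_mem i).1

lemma isoPairs_nonneg : 0 ≤ isoPairs h h' B K x v :=
  Finset.sum_nonneg fun i _ => Finset.sum_nonneg fun j _ =>
    mul_nonneg (isoInd_mem i).1 (isoInd_mem j).1

lemma isoCount_le_card : isoCount h B K x v ≤ (window x K).card := by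
  refine (Finset.sum_le_sum fun i _ => (isoInd_mem i).2).trans ?_
  simp

lemma isoCount_le : isoCount h B K x v ≤ ((window x K).card : ℝ) ^ 2 := by
  refine isoCount_le_card.trans ?_
  exact_mod_cast Nat.le_self_pow two_ne_zero _

lemma isoPairs_le : isoPairs h h' B K x v ≤ ((window x K).card : ℝ) ^ 2 := by
  have h2 : ∀ i ∈ window x K, ∑ j ∈ (window x K).erase i, isoInd h B x v i * isoInd h' B x v j
      ≤ ((window x K).card : ℝ) := by
    intro i _
    refine (Finset.sum_le_sum fun j _ => mul_le_one₀ (isoInd_mem i).2 (isoInd_mem j).1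
      (isoInd_mem j).2).trans ?_
    simp only [Finset.sum_const, nsmul_eq_mul, mul_one]
    exact_mod_cast Finset.card_erase_le
  refine (Finset.sum_le_sum h2).trans ?_
  simp [sq]

end Bounds

section Window

variable {h h' : ℝ → ℝ} {B K : Set (E d)}

lemma ae_continuousAt_indicator (hK : volume (frontier K) = 0) :
    ∀ᵐ x : E d, ContinuousAt (K.indicator fun _ => (1 : ℝ)) x := by
  have : ∀ᵐ x : E d, x ∉ frontier K := by rw [ae_iff]; simpa using hK
  filter_upwards [this] with x hx
  by_cases hxc : x ∈ closure K
  · have hxi : x ∈ interior K := by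
      by_contra hxi
      exact hx ⟨hxc, hxi⟩
    refine (continuousAt_const (y := (1 : ℝ))).congr ?_
    filter_upwards [isOpen_interior.mem_nhds hxi] with y hy
    simp [interior_subset hy]
  · refine (continuousAt_const (y := (0 : ℝ))).congr ?_
    filter_upwards [isClosed_closure.isOpen_compl.mem_nhds hxc] with y hy
    have : y ∉ K := fun h => hy (subset_closure h)
    simp [this]

lemma indicator_one_mem (K : Set (E d)) (x : E d) :
    K.indicator (fun _ => (1 : ℝ)) x ∈ Set.Icc (0 : ℝ) 1 := by
  by_cases hx : x ∈ K <;> simp [hx]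

/-- The event that `i` lies in `K` and has no neighbour in `B`. -/
def isoEvent (h : ℝ → ℝ) (B K : Set (E d)) (i : ℕ) : Set ((ℕ → E d) × (Sym2 ℕ → ℝ)) :=
  {q | q.1 i ∈ K ∧ IsolatedIn h B q.1 q.2 i}

/-- The event that `i` and `j` are different and lie in `K`, and have no neighbours in `B`, for `h`
and `h'` respectively. -/
def isoPairEvent (h h' : ℝ → ℝ) (B K : Set (E d)) (t : ℕ × ℕ) :
    Set ((ℕ → E d) × (Sym2 ℕ → ℝ)) :=
  {q | (t.1 ≠ t.2 ∧ q.1 t.1 ∈ K ∧ q.1 t.2 ∈ K) ∧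
    IsolatedIn h B q.1 q.2 t.1 ∧ IsolatedIn h' B q.1 q.2 t.2}

lemma measurableSet_isoEvent (hh : IsProfile d h) (hB : MeasurableSet B) (hK : MeasurableSet K)
    (i : ℕ) : MeasurableSet (isoEvent h B K i) :=
  (hK.preimage ((measurable_pi_apply i).comp measurable_fst)).inter
    (measurableSet_isolatedIn hh hB i)

lemma measurableSet_isoPairEvent (hh : IsProfile d h) (hh' : IsProfile d h')
    (hB : MeasurableSet B) (hK : MeasurableSet K) (t : ℕ × ℕ) :
    MeasurableSet (isoPairEvent h h' B K t) :=
  MeasurableSet.inter ((MeasurableSet.const _).inter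
    ((hK.preimage ((measurable_pi_apply t.1).comp measurable_fst)).inter
    (hK.preimage ((measurable_pi_apply t.2).comp measurable_fst))))
    ((measurableSet_isolatedIn hh hB t.1).inter (measurableSet_isolatedIn hh' hB t.2))

lemma tsum_indicator_isoEvent {x : ℕ → E d} {v : Sym2 ℕ → ℝ} (hfin : {i | x i ∈ K}.Finite) :
    ∑' i, (isoEvent h B K i).indicator (fun _ => (1 : ENNReal)) (x, v)
      = ENNReal.ofReal (isoCount h B K x v) := by
  rw [tsum_eq_sum (s := window x K), isoCount, ENNReal.ofReal_sum_of_nonneg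
    fun i _ => (isoInd_mem i).1]
  · refine Finset.sum_congr rfl fun i hi => ?_
    have hi' : x i ∈ K := (mem_window hfin).mp hi
    by_cases a : IsolatedIn h B x v i
    · rw [Set.indicator_of_mem (show (x, v) ∈ isoEvent h B K i from ⟨hi', a⟩)]
      simp [isoInd, a]
    · rw [Set.indicator_of_notMem (fun hm : (x, v) ∈ isoEvent h B K i => a hm.2)]
      simp [isoInd, a]
  · intro i hi
    rw [Set.indicator_of_notMem
      (fun hm : (x, v) ∈ isoEvent h B K i => hi ((mem_window hfin).mpr hm.1))]

lemma tsum_indicator_isoPairEvent {x : ℕ → E d} {v : Sym2 ℕ → ℝ} (hfin : {i | x i ∈ K}.Finite) :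
    ∑' t, (isoPairEvent h h' B K t).indicator (fun _ => (1 : ENNReal)) (x, v)
      = ENNReal.ofReal (isoPairs h h' B K x v) := by
  rw [ENNReal.tsum_prod', tsum_tsum_eq_sum_erase (S := window x K), isoPairs,
      ENNReal.ofReal_sum_of_nonneg fun i _ => Finset.sum_nonneg fun j _ =>
        mul_nonneg (isoInd_mem i).1 (isoInd_mem j).1]
  · refine Finset.sum_congr rfl fun i hi => ?_
    rw [ENNReal.ofReal_sum_of_nonneg fun j _ => mul_nonneg (isoInd_mem i).1 (isoInd_mem j).1]
    refine Finset.sum_congr rfl fun j hj => ?_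
    have h1 : x i ∈ K := (mem_window hfin).mp hi
    have h2 : x j ∈ K := (mem_window hfin).mp (Finset.mem_of_mem_erase hj)
    have h3 : i ≠ j := (Finset.ne_of_mem_erase hj).symm
    by_cases a : IsolatedIn h B x v i ∧ IsolatedIn h' B x v j
    · rw [Set.indicator_of_mem (show (x, v) ∈ isoPairEvent h h' B K (i, j) from ⟨⟨h3, h1, h2⟩, a⟩)]
      simp [isoInd, a.1, a.2]
    · rw [Set.indicator_of_notMem (fun hm : (x, v) ∈ isoPairEvent h h' B K (i, j) => a hm.2)]
      rw [not_and_or] at a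
      rcases a with a | a <;> simp [isoInd, a]
  · intro i j hij
    rw [Set.indicator_of_notMem (fun hm : (x, v) ∈ isoPairEvent h h' B K (i, j) =>
      hij ⟨(mem_window hfin).mpr hm.1.2.1, (mem_window hfin).mpr hm.1.2.2, hm.1.1⟩)]

lemma prod_sub_nonneg (hh : IsProfile d h) (S : Finset ℕ) (x : ℕ → E d) (i : ℕ) :
    0 ≤ ∏ k ∈ S, (1 - h ‖x i - x k‖) := Finset.prod_nonneg fun _ _ => (hh.sub_mem_Icc _ _).1

lemma IsMarkedPoissonProcess.tsum_measure_isoEvent [IsProbabilityMeasure P]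
    (hX : IsMarkedPoissonProcess P lam ξ u) (hh : IsProfile d h) (hKB : K ⊆ B) {x : ℕ → E d}
    (hfin : {i | x i ∈ B}.Finite) :
    ∑' i, P {ω' | (x, (fun e => u e ω')) ∈ isoEvent h B K i}
      = ENNReal.ofReal (singleSum (window x B) x (K.indicator fun _ => (1 : ℝ))
          (fun x z => 1 - h ‖x - z‖)) := by
  unfold singleSum
  rw [tsum_eq_sum (s := window x B), ENNReal.ofReal_sum_of_nonneg
    fun i _ => mul_nonneg (indicator_one_mem K _).1 (prod_sub_nonneg hh _ x i)]
  · refine Finset.sum_congr rfl fun i hi => ?_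
    by_cases hiK : x i ∈ K
    · simp only [isoEvent, Set.mem_ofPred_eq, hiK, true_and, Set.indicator_of_mem, one_mul]
      exact hX.measure_isolatedIn hh hfin i
    · simp [isoEvent, hiK]
  · intro i hi
    rw [mem_window hfin] at hi
    have hiK : x i ∉ K := fun hiK => hi (hKB hiK)
    simp [isoEvent, hiK]

/-- The weight `1_K(x) 1_K(y) (1 - h(|x - y|))`. -/
noncomputable def pairWeight (h : ℝ → ℝ) (K : Set (E d)) (x y : E d) : ℝ :=
  K.indicator (fun _ => (1 : ℝ)) x * K.indicator (fun _ => (1 : ℝ)) y * (1 - h ‖x - y‖)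

lemma pairWeight_mem (hh : IsProfile d h) (x y : E d) :
    pairWeight h K x y ∈ Set.Icc (0 : ℝ) 1 := by
  have h1 := indicator_one_mem K x
  have h2 := indicator_one_mem K y
  have h3 := hh.sub_mem_Icc x y
  exact ⟨mul_nonneg (mul_nonneg h1.1 h2.1) h3.1,
    mul_le_one₀ (mul_le_one₀ h1.2 h2.1 h2.2) h3.1 h3.2⟩

lemma ae_continuousAt_pairWeight (hd : 1 ≤ d) (hh : IsProfile d h)
    (hKf : volume (frontier K) = 0) :
    ∀ᵐ q ∂(volume : Measure (E d)).prod volume,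
      ContinuousAt (Function.uncurry (pairWeight h K)) q := by
  have c1 := Measure.quasiMeasurePreserving_fst (μ := (volume : Measure (E d)))
    (ν := (volume : Measure (E d))) |>.ae (ae_continuousAt_indicator hKf)
  have c2 := Measure.quasiMeasurePreserving_snd (μ := (volume : Measure (E d)))
    (ν := (volume : Measure (E d))) |>.ae (ae_continuousAt_indicator hKf)
  filter_upwards [c1, c2, hh.ae_continuousAt hd] with q h1 h2 h3
  exact ((ContinuousAt.comp (f := Prod.fst) h1 continuousAt_fst).mul
    (ContinuousAt.comp (f := Prod.snd) h2 continuousAt_snd)).mul h3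

lemma pairTerm_nonneg (hh : IsProfile d h) (hh' : IsProfile d h') (S : Finset ℕ) (x : ℕ → E d)
    (i j : ℕ) : 0 ≤ pairWeight h' K (x i) (x j) *
      ∏ k ∈ S, (1 - h ‖x i - x k‖) * (1 - h' ‖x j - x k‖) :=
  mul_nonneg (pairWeight_mem hh' _ _).1 (Finset.prod_nonneg fun _ _ =>
    mul_nonneg (hh.sub_mem_Icc _ _).1 (hh'.sub_mem_Icc _ _).1)

lemma IsMarkedPoissonProcess.tsum_measure_isoPairEvent [IsProbabilityMeasure P]
    (hX : IsMarkedPoissonProcess P lam ξ u) (hh : IsProfile d h) (hh' : IsProfile d h')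
    (hle : ∀ r, 0 ≤ r → h r ≤ h' r) (hKB : K ⊆ B) {x : ℕ → E d}
    (hfin : {i | x i ∈ B}.Finite) :
    ∑' t, P {ω' | (x, (fun e => u e ω')) ∈ isoPairEvent h h' B K t}
      = ENNReal.ofReal (pairSum (window x B) x (pairWeight h' K)
          (fun x y z => (1 - h ‖x - z‖) * (1 - h' ‖y - z‖))) := by
  unfold pairSum
  rw [ENNReal.tsum_prod', tsum_tsum_eq_sum_erase (S := window x B), ENNReal.ofReal_sum_of_nonneg
    fun i _ => Finset.sum_nonneg fun j _ => pairTerm_nonneg hh hh' _ x i j]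
  · refine Finset.sum_congr rfl fun i hi => ?_
    rw [ENNReal.ofReal_sum_of_nonneg fun j _ => pairTerm_nonneg hh hh' _ x i j]
    refine Finset.sum_congr rfl fun j hj => ?_
    have h1 : x i ∈ B := (mem_window hfin).mp hi
    have h2 : x j ∈ B := (mem_window hfin).mp (Finset.mem_of_mem_erase hj)
    have h3 : i ≠ j := (Finset.ne_of_mem_erase hj).symm
    by_cases hK : x i ∈ K ∧ x j ∈ K
    · simp only [isoPairEvent, Set.mem_ofPred_eq, hK.1, hK.2, ne_eq, h3,
          not_false_eq_true, true_and, pairWeight, Set.indicator_of_mem, one_mul]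
      exact hX.measure_isolatedIn_and hh hh' hle hfin h3 h1 h2
    · have h0 : {ω' | (x, (fun e => u e ω')) ∈ isoPairEvent h h' B K (i, j)} = ∅ :=
        Set.eq_empty_of_forall_notMem fun ω' hm => hK hm.1.2
      rw [h0, measure_empty]
      rw [not_and_or] at hK
      rcases hK with hK | hK <;> simp [pairWeight, hK]
  · intro i j hij
    have h0 : {ω' | (x, (fun e => u e ω')) ∈ isoPairEvent h h' B K (i, j)} = ∅ :=
      Set.eq_empty_of_forall_notMem fun ω' hm => hij ⟨(mem_window hfin).mpr (hKB hm.1.2.1),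
        (mem_window hfin).mpr (hKB hm.1.2.2), hm.1.1⟩
    rw [h0, measure_empty]

lemma IsMarkedPoissonProcess.integral_isoCount_window [IsProbabilityMeasure P]
    (hX : IsMarkedPoissonProcess P lam ξ u) (hlam : 0 ≤ lam) (hd : 1 ≤ d) (hh : IsProfile d h)
    (hB : MeasurableSet B) (hB' : volume B ≠ ⊤) (hK : MeasurableSet K)
    (hKf : volume (frontier K) = 0) (hKB : K ⊆ B) :
    AEStronglyMeasurable
      (fun ω => isoCount h B K (fun i => ξ i ω) (fun e => u e ω)) P ∧
    ∫ ω, isoCount h B K (fun i => ξ i ω) (fun e => u e ω) ∂P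
      = lam * ∫ x in K, Real.exp (-lam * ∫ z in B, h ‖x - z‖) := by
  have hG : ∀ x, |K.indicator (fun _ => (1 : ℝ)) x| ≤ 1 := fun x => by
    rw [abs_of_nonneg (indicator_one_mem K x).1]; exact (indicator_one_mem K x).2
  obtain ⟨hint, hval⟩ := hX.poisson.integral_singleSum hlam hB hB' hG
    (fun x z => hh.sub_mem_Icc x z) (ae_continuousAt_indicator hKf) (hh.ae_continuousAt hd)
  have key := hX.integral_eq_of_tsum (A := isoEvent h B K)
    (X := fun ω => isoCount h B K (fun i => ξ i ω) (fun e => u e ω))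
    (Z := fun ω => singleSum (window (fun i => ξ i ω) B) (fun i => ξ i ω)
      (K.indicator fun _ => (1 : ℝ)) (fun x z => 1 - h ‖x - z‖))
    (fun i => measurableSet_isoEvent hh hB hK i) (fun ω => isoCount_nonneg)
    (fun ω => Finset.sum_nonneg fun i _ => mul_nonneg (indicator_one_mem K _).1
      (prod_sub_nonneg hh _ (fun i => ξ i ω) i)) hint
    (by
      filter_upwards [hX.poisson.ae_finite hB hB'] with ω hω
      exact tsum_indicator_isoEvent (hω.subset fun i hi => hKB hi))
    (by
      filter_upwards [hX.poisson.ae_finite hB hB'] with ω hω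
      exact hX.tsum_measure_isoEvent hh hKB hω)
  refine ⟨key.1, key.2.trans (hval.trans ?_)⟩
  congr 1
  have : ∀ x, K.indicator (fun _ => (1 : ℝ)) x *
      Real.exp (-lam * ∫ z in B, (1 - (1 - h ‖x - z‖))) =
      K.indicator (fun x => Real.exp (-lam * ∫ z in B, h ‖x - z‖)) x := by
    intro x
    by_cases hx : x ∈ K <;> simp [hx]
  simp only [this]
  rw [setIntegral_indicator hK, Set.inter_eq_self_of_subset_right hKB]

lemma IsMarkedPoissonProcess.integral_isoPairs_window [IsProbabilityMeasure P]
    (hX : IsMarkedPoissonProcess P lam ξ u) (hlam : 0 ≤ lam) (hd : 1 ≤ d) (hh : IsProfile d h)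
    (hh' : IsProfile d h') (hle : ∀ r, 0 ≤ r → h r ≤ h' r)
    (hB : MeasurableSet B) (hB' : volume B ≠ ⊤) (hK : MeasurableSet K)
    (hKf : volume (frontier K) = 0) (hKB : K ⊆ B) :
    AEStronglyMeasurable
      (fun ω => isoPairs h h' B K (fun i => ξ i ω) (fun e => u e ω)) P ∧
    ∫ ω, isoPairs h h' B K (fun i => ξ i ω) (fun e => u e ω) ∂P
      = lam ^ 2 * ∫ x in K, ∫ y in K, (1 - h' ‖x - y‖) *
          Real.exp (-lam * ∫ z in B, (1 - (1 - h ‖x - z‖) * (1 - h' ‖y - z‖))) := by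
  have hG : ∀ x y, |pairWeight h' K x y| ≤ 1 := fun x y => by
    rw [abs_of_nonneg (pairWeight_mem hh' x y).1]; exact (pairWeight_mem hh' x y).2
  obtain ⟨hint, hval⟩ := hX.poisson.integral_pairSum hlam hB hB' hG
    (fun x z => hh.sub_mem_Icc x z) (fun x z => hh'.sub_mem_Icc x z)
    (ae_continuousAt_pairWeight hd hh' hKf) (hh.ae_continuousAt hd) (hh'.ae_continuousAt hd)
  have key := hX.integral_eq_of_tsum (A := isoPairEvent h h' B K)
    (X := fun ω => isoPairs h h' B K (fun i => ξ i ω) (fun e => u e ω))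
    (Z := fun ω => pairSum (window (fun i => ξ i ω) B) (fun i => ξ i ω) (pairWeight h' K)
      (fun x y z => (1 - h ‖x - z‖) * (1 - h' ‖y - z‖)))
    (fun t => measurableSet_isoPairEvent hh hh' hB hK t) (fun ω => isoPairs_nonneg)
    (fun ω => Finset.sum_nonneg fun i _ => Finset.sum_nonneg fun j _ =>
      pairTerm_nonneg hh hh' _ (fun i => ξ i ω) i j) hint
    (by
      filter_upwards [hX.poisson.ae_finite hB hB'] with ω hω
      exact tsum_indicator_isoPairEvent (hω.subset fun i hi => hKB hi))
    (by
      filter_upwards [hX.poisson.ae_finite hB hB'] with ω hω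
      exact hX.tsum_measure_isoPairEvent hh hh' hle hKB hω)
  refine ⟨key.1, key.2.trans (hval.trans ?_)⟩
  congr 1
  have e1 : ∀ x y, pairWeight h' K x y *
      Real.exp (-lam * ∫ z in B, (1 - (1 - h ‖x - z‖) * (1 - h' ‖y - z‖))) =
      K.indicator (fun _ => (1 : ℝ)) x * K.indicator (fun y => (1 - h' ‖x - y‖) *
        Real.exp (-lam * ∫ z in B, (1 - (1 - h ‖x - z‖) * (1 - h' ‖y - z‖)))) y := by
    intro x y
    by_cases hx : x ∈ K <;> by_cases hy : y ∈ K <;> simp [hx, hy, pairWeight]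
  simp only [e1, integral_const_mul]
  simp only [setIntegral_indicator hK, Set.inter_eq_self_of_subset_right hKB]
  have e2 : ∀ x, K.indicator (fun _ => (1 : ℝ)) x * (∫ y in K, (1 - h' ‖x - y‖) *
        Real.exp (-lam * ∫ z in B, (1 - (1 - h ‖x - z‖) * (1 - h' ‖y - z‖)))) =
      K.indicator (fun x => ∫ y in K, (1 - h' ‖x - y‖) *
        Real.exp (-lam * ∫ z in B, (1 - (1 - h ‖x - z‖) * (1 - h' ‖y - z‖)))) x := by
    intro x
    by_cases hx : x ∈ K <;> simp [hx]
  simp only [e2]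
  rw [setIntegral_indicator hK, Set.inter_eq_self_of_subset_right hKB]

end Window

end RandomConnection

namespace RandomConnection

variable {d : ℕ} {Ω : Type*} [MeasurableSpace Ω] {P : Measure Ω} {lam : ℝ} {ξ : ℕ → Ω → E d}
  {u : Sym2 ℕ → Ω → ℝ} {h h' : ℝ → ℝ} {K : Set (E d)}

/-! ### Letting the window grow -/

/-- Balls exhausting `ℝ^d`. -/
def bigBall (d m : ℕ) : Set (E d) := Metric.closedBall 0 m

lemma aecover_bigBall (d : ℕ) : AECover (volume : Measure (E d)) atTop (bigBall d) :=
  aecover_closedBall tendsto_natCast_atTop_atTop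

lemma eventually_subset_bigBall (hK : Bornology.IsBounded K) :
    ∀ᶠ m in atTop, K ⊆ bigBall d m := by
  obtain ⟨r, hr⟩ := hK.subset_closedBall 0
  filter_upwards [tendsto_natCast_atTop_atTop.eventually_ge_atTop r] with m hm
  exact hr.trans (Metric.closedBall_subset_closedBall hm)

lemma measurableSet_bigBall (m : ℕ) : MeasurableSet (bigBall d m) :=
  Metric.isClosed_closedBall.measurableSet

lemma volume_bigBall_ne_top (m : ℕ) : volume (bigBall d m) ≠ ⊤ :=
  measure_closedBall_lt_top.ne

lemma tendsto_isoInd (x : ℕ → E d) (v : Sym2 ℕ → ℝ) (i : ℕ) :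
    Tendsto (fun m => isoInd h (bigBall d m) x v i) atTop (𝓝 (isoInd h Set.univ x v i)) := by
  refine tendsto_const_nhds.congr' ?_
  by_cases hi : IsolatedIn h Set.univ x v i
  · refine Eventually.of_forall fun m => ?_
    have : IsolatedIn h (bigBall d m) x v i := fun k hk _ => hi k hk (Set.mem_univ _)
    simp [isoInd, hi, this]
  · have hi' := hi
    simp only [IsolatedIn, not_forall] at hi'
    obtain ⟨k, hk, _, hk2⟩ := hi'
    filter_upwards [eventually_subset_bigBall (Bornology.isBounded_singleton (x := x k))]
      with m hm
    have : ¬ IsolatedIn h (bigBall d m) x v i := fun hh => hk2 (hh k hk (hm rfl))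
    simp [isoInd, hi, this]

lemma tendsto_isoCount (x : ℕ → E d) (v : Sym2 ℕ → ℝ) :
    Tendsto (fun m => isoCount h (bigBall d m) K x v) atTop (𝓝 (isoCount h Set.univ K x v)) :=
  tendsto_finsetSum _ fun i _ => tendsto_isoInd x v i

lemma tendsto_isoPairs (x : ℕ → E d) (v : Sym2 ℕ → ℝ) :
    Tendsto (fun m => isoPairs h h' (bigBall d m) K x v) atTop
      (𝓝 (isoPairs h h' Set.univ K x v)) :=
  tendsto_finsetSum _ fun i _ => tendsto_finsetSum _ fun j _ =>
    (tendsto_isoInd x v i).mul (tendsto_isoInd x v j)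

lemma IsProfile.integrable_sub (hh : IsProfile d h) (x : E d) :
    Integrable (fun z : E d => h ‖x - z‖) :=
  hh.integrable.comp_sub_left x

lemma IsProfile.integrable_mul (hh : IsProfile d h) (hh' : IsProfile d h') (x y : E d) :
    Integrable (fun z : E d => h ‖x - z‖ * h' ‖y - z‖) := by
  refine (hh.integrable_sub x).mono' ?_ (ae_of_all _ fun z => ?_)
  · exact (hh.integrable_sub x).aestronglyMeasurable.mul
      (hh'.integrable_sub y).aestronglyMeasurable
  · rw [Real.norm_eq_abs, abs_of_nonneg (mul_nonneg (hh.nonneg _) (hh'.nonneg _))]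
    exact mul_le_of_le_one_right (hh.nonneg _) (hh'.le_one _)

lemma integral_sub_two_mul_add {α : Type*} [MeasurableSpace α] {μ : Measure α} {f g k : α → ℝ}
    (hf : Integrable f μ) (hg : Integrable g μ) (hk : Integrable k μ) :
    ∫ x, (f x - 2 * g x + k x) ∂μ = ∫ x, f x ∂μ - 2 * ∫ x, g x ∂μ + ∫ x, k x ∂μ := by
  have h1 : Integrable (fun x => f x - 2 * g x) μ := hf.sub (hg.const_mul 2)
  rw [integral_add h1 hk, integral_sub hf (hg.const_mul 2), integral_const_mul]

lemma p_eq (x : E d) :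
    p d lam h = Real.exp (-lam * ∫ z, h ‖x - z‖) := by
  rw [p, integral_sub_left_eq_self (fun y : E d => h ‖y‖)]

/-- Inclusion-exclusion for the exponent of the two-point function. -/
lemma exp_pair_eq (hh : IsProfile d h) (hh' : IsProfile d h') (x y : E d) :
    Real.exp (-lam * ∫ z, (1 - (1 - h ‖x - z‖) * (1 - h' ‖y - z‖)))
      = p d lam h * p d lam h' * pp lam h h' x y := by
  have h1 : ∀ z, 1 - (1 - h ‖x - z‖) * (1 - h' ‖y - z‖)
      = h ‖x - z‖ + h' ‖y - z‖ - h ‖x - z‖ * h' ‖y - z‖ := fun z => by ring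
  simp only [h1]
  have hadd : Integrable (fun z => h ‖x - z‖ + h' ‖y - z‖) :=
    (hh.integrable_sub x).add (hh'.integrable_sub y)
  rw [integral_sub hadd (hh.integrable_mul hh' x y),
    integral_add (hh.integrable_sub x) (hh'.integrable_sub y), p_eq x, p_eq y, pp,
    ← Real.exp_add, ← Real.exp_add]
  simp only [norm_sub_rev x, norm_sub_rev y]
  ring_nf

lemma integrable_one_sub_mul (hh : IsProfile d h) (hh' : IsProfile d h') (x y : E d) :
    Integrable (fun z => (1 - (1 - h ‖x - z‖) * (1 - h' ‖y - z‖))) := by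
  have h1 : ∀ z, 1 - (1 - h ‖x - z‖) * (1 - h' ‖y - z‖)
      = h ‖x - z‖ + h' ‖y - z‖ - h ‖x - z‖ * h' ‖y - z‖ := fun z => by ring
  simp only [h1]
  exact ((hh.integrable_sub x).add (hh'.integrable_sub y)).sub (hh.integrable_mul hh' x y)

lemma exp_neg_mul_setIntegral_le_one {B : Set (E d)} (hlam : 0 ≤ lam) {f : E d → ℝ}
    (hf : ∀ z, 0 ≤ f z) : ‖Real.exp (-lam * ∫ z in B, f z)‖ ≤ 1 := by
  rw [Real.norm_eq_abs, abs_of_pos (Real.exp_pos _), Real.exp_le_one_iff]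
  have : 0 ≤ ∫ z in B, f z := integral_nonneg hf
  nlinarith

lemma measurable_exp_setIntegral {α : Type*} [MeasurableSpace α] {B : Set (E d)}
    {f : α × E d → ℝ} (hf : Measurable f) :
    Measurable (fun a => Real.exp (-lam * ∫ z in B, f (a, z))) :=
  Real.measurable_exp.comp (measurable_const.mul hf.stronglyMeasurable.integral_prod_right'.measurable)

/-- The mean number of isolated vertices in `K`. -/
lemma IsMarkedPoissonProcess.integral_isoCount [IsProbabilityMeasure P]
    (hX : IsMarkedPoissonProcess P lam ξ u) (hlam : 0 ≤ lam) (hd : 1 ≤ d) (hh : IsProfile d h)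
    (hK : MeasurableSet K) (hKb : Bornology.IsBounded K) (hKf : volume (frontier K) = 0) :
    AEStronglyMeasurable
      (fun ω => isoCount h Set.univ K (fun i => ξ i ω) (fun e => u e ω)) P ∧
    ∫ ω, isoCount h Set.univ K (fun i => ξ i ω) (fun e => u e ω) ∂P
      = lam * volume.real K * p d lam h := by
  have hK' : volume K ≠ ⊤ := hKb.measure_lt_top.ne
  have hfin : IsFiniteMeasure (volume.restrict K) := ⟨by simpa using hK'.lt_top⟩
  obtain ⟨M, hM⟩ := eventually_atTop.mp (eventually_subset_bigBall hKb)
  have hw := fun m : ℕ => hX.integral_isoCount_window hlam hd hh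
    (measurableSet_bigBall (m + M)) (volume_bigBall_ne_top (m + M)) hK hKf
    (hM _ (Nat.le_add_left M m))
  have hlim : ∀ ω, Tendsto (fun m : ℕ => isoCount h (bigBall d (m + M)) K (fun i => ξ i ω)
      (fun e => u e ω)) atTop (𝓝 (isoCount h Set.univ K (fun i => ξ i ω) (fun e => u e ω))) :=
    fun ω => (tendsto_isoCount _ _).comp (tendsto_add_atTop_nat M)
  refine ⟨aestronglyMeasurable_of_tendsto_ae _ (fun m => (hw m).1) (ae_of_all _ hlim), ?_⟩
  have t1 := tendsto_integral_of_dominated_convergence _ (fun m => (hw m).1)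
    (hX.poisson.integrable_card_sq hK hK')
    (fun m => ae_of_all _ fun ω => by
      rw [Real.norm_eq_abs, abs_of_nonneg isoCount_nonneg]; exact isoCount_le)
    (ae_of_all _ hlim)
  refine tendsto_nhds_unique t1 ?_
  simp only [fun m => (hw m).2]
  have e : lam * volume.real K * p d lam h = lam * ∫ x in K, p d lam h := by
    simp; ring
  rw [e]
  refine Tendsto.const_mul _ (tendsto_integral_of_dominated_convergence (fun _ => 1) (fun m => ?_)
    (integrable_const _) (fun m => ae_of_all _ fun x =>
      exp_neg_mul_setIntegral_le_one hlam fun z => hh.nonneg _) (ae_of_all _ fun x => ?_))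
  · exact (measurable_exp_setIntegral hh.measurable_sub).aestronglyMeasurable
  · rw [p_eq x]
    refine (Real.continuous_exp.tendsto _).comp (Tendsto.const_mul _ ?_)
    exact ((aecover_bigBall d).integral_tendsto_of_countably_generated
      (hh.integrable_sub x)).comp (tendsto_add_atTop_nat M)

/-- The mean number of ordered pairs of different vertices in `K`, the first isolated for `h` and
the second for the larger function `h'`. -/
lemma IsMarkedPoissonProcess.integral_isoPairs [IsProbabilityMeasure P]
    (hX : IsMarkedPoissonProcess P lam ξ u) (hlam : 0 ≤ lam) (hd : 1 ≤ d) (hh : IsProfile d h)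
    (hh' : IsProfile d h') (hle : ∀ r, 0 ≤ r → h r ≤ h' r)
    (hK : MeasurableSet K) (hKb : Bornology.IsBounded K) (hKf : volume (frontier K) = 0) :
    AEStronglyMeasurable
      (fun ω => isoPairs h h' Set.univ K (fun i => ξ i ω) (fun e => u e ω)) P ∧
    ∫ ω, isoPairs h h' Set.univ K (fun i => ξ i ω) (fun e => u e ω) ∂P
      = lam ^ 2 * ∫ x in K, ∫ y in K, (1 - h' ‖x - y‖) *
          (p d lam h * p d lam h' * pp lam h h' x y) := by
  have hK' : volume K ≠ ⊤ := hKb.measure_lt_top.ne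
  have hfin : IsFiniteMeasure (volume.restrict K) := ⟨by simpa using hK'.lt_top⟩
  obtain ⟨M, hM⟩ := eventually_atTop.mp (eventually_subset_bigBall hKb)
  have hw := fun m : ℕ => hX.integral_isoPairs_window hlam hd hh hh' hle
    (measurableSet_bigBall (m + M)) (volume_bigBall_ne_top (m + M)) hK hKf
    (hM _ (Nat.le_add_left M m))
  have hlim : ∀ ω, Tendsto (fun m : ℕ => isoPairs h h' (bigBall d (m + M)) K (fun i => ξ i ω)
      (fun e => u e ω)) atTop (𝓝 (isoPairs h h' Set.univ K (fun i => ξ i ω) (fun e => u e ω))) :=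
    fun ω => (tendsto_isoPairs _ _).comp (tendsto_add_atTop_nat M)
  refine ⟨aestronglyMeasurable_of_tendsto_ae _ (fun m => (hw m).1) (ae_of_all _ hlim), ?_⟩
  have t1 := tendsto_integral_of_dominated_convergence _ (fun m => (hw m).1)
    (hX.poisson.integrable_card_sq hK hK')
    (fun m => ae_of_all _ fun ω => by
      rw [Real.norm_eq_abs, abs_of_nonneg isoPairs_nonneg]; exact isoPairs_le)
    (ae_of_all _ hlim)
  refine tendsto_nhds_unique t1 ?_
  simp only [fun m => (hw m).2]
  have hnn : ∀ x y z : E d, 0 ≤ 1 - (1 - h ‖x - z‖) * (1 - h' ‖y - z‖) := fun x y z => by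
    have h1 := hh.sub_mem_Icc x z
    have h2 := hh'.sub_mem_Icc y z
    linarith [mul_le_one₀ h1.2 h2.1 h2.2]
  have hmeas : ∀ B : Set (E d), Measurable (fun q : E d × E d => (1 - h' ‖q.1 - q.2‖) *
      Real.exp (-lam * ∫ z in B, (1 - (1 - h ‖q.1 - z‖) * (1 - h' ‖q.2 - z‖)))) := by
    intro B
    refine (measurable_const.sub hh'.measurable_sub).mul (measurable_exp_setIntegral
      (f := fun w : (E d × E d) × E d => 1 - (1 - h ‖w.1.1 - w.2‖) * (1 - h' ‖w.1.2 - w.2‖)) ?_)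
    exact measurable_const.sub ((measurable_const.sub (hh.measurable_norm.comp
      (measurable_fst.fst.sub measurable_snd))).mul (measurable_const.sub
      (hh'.measurable_norm.comp (measurable_fst.snd.sub measurable_snd))))
  have hb : ∀ (B : Set (E d)) (x y : E d), ‖(1 - h' ‖x - y‖) *
      Real.exp (-lam * ∫ z in B, (1 - (1 - h ‖x - z‖) * (1 - h' ‖y - z‖)))‖ ≤ 1 := by
    intro B x y
    rw [norm_mul, Real.norm_eq_abs (1 - h' ‖x - y‖), abs_of_nonneg (hh'.sub_mem_Icc x y).1]
    exact mul_le_one₀ (hh'.sub_mem_Icc x y).2 (norm_nonneg _)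
      (exp_neg_mul_setIntegral_le_one hlam fun z => hnn x y z)
  refine Tendsto.const_mul _ (tendsto_integral_of_dominated_convergence
    (fun _ => volume.real K) (fun m => ?_) (integrable_const _)
    (fun m => ae_of_all _ fun x => ?_) (ae_of_all _ fun x => ?_))
  · exact (hmeas _).stronglyMeasurable.integral_prod_right'.aestronglyMeasurable
  · refine (norm_integral_le_of_norm_le_const (ae_of_all _ fun y => hb _ x y)).trans ?_
    simp
  · refine tendsto_integral_of_dominated_convergence (fun _ => 1) (fun m =>
      ((hmeas _).comp measurable_prodMk_left).aestronglyMeasurable) (integrable_const _)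
      (fun m => ae_of_all _ fun y => hb _ x y) (ae_of_all _ fun y => Tendsto.const_mul _ ?_)
    rw [← exp_pair_eq hh hh' x y]
    refine (Real.continuous_exp.tendsto _).comp (Tendsto.const_mul _ ?_)
    exact ((aecover_bigBall d).integral_tendsto_of_countably_generated
      (integrable_one_sub_mul hh hh' x y)).comp (tendsto_add_atTop_nat M)

/-! ### The first two moments of the number of lost isolated vertices -/

lemma isoInd_mul_isoInd {B : Set (E d)} {x : ℕ → E d} {v : Sym2 ℕ → ℝ}
    (hle : ∀ r, 0 ≤ r → h r ≤ h' r) (i : ℕ) :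
    isoInd h B x v i * isoInd h' B x v i = isoInd h' B x v i := by
  by_cases h1 : IsolatedIn h' B x v i
  · have : IsolatedIn h B x v i := fun k hk hkB =>
      (hle _ (norm_nonneg _)).trans (h1 k hk hkB)
    simp [isoInd, h1, this]
  · simp [isoInd, h1]

/-- The diagonal of the product counts the vertices isolated for the larger function `h'`. -/
lemma isoCount_mul_isoCount {B : Set (E d)} {x : ℕ → E d} {v : Sym2 ℕ → ℝ}
    (hle : ∀ r, 0 ≤ r → h r ≤ h' r) :
    isoCount h B K x v * isoCount h' B K x v = isoCount h' B K x v + isoPairs h h' B K x v := by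
  unfold isoCount isoPairs
  rw [Finset.sum_mul_sum, ← Finset.sum_add_distrib]
  refine Finset.sum_congr rfl fun i hi => ?_
  rw [← Finset.add_sum_erase _ _ hi, isoInd_mul_isoInd hle]

/-- A vertex that is isolated for `h'` is isolated for the smaller function `h`. -/
lemma ncard_lostIsolated_eq {x : ℕ → E d} {v : Sym2 ℕ → ℝ}
    (hle : ∀ r, 0 ≤ r → h r ≤ h' r) (hfin : {i | x i ∈ K}.Finite) :
    ((lostIsolated K h h' x v).ncard : ℝ)
      = isoCount h Set.univ K x v - isoCount h' Set.univ K x v := by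
  classical
  have h1 : lostIsolated K h h' x v = (((window x K).filter fun i =>
      IsolatedIn h Set.univ x v i ∧ ¬ IsolatedIn h' Set.univ x v i : Finset ℕ) : Set ℕ) := by
    ext i
    simp [lostIsolated, mem_window hfin, isolatedIn_univ]
  rw [h1, Set.ncard_coe_finset, isoCount, isoCount, ← Finset.sum_sub_distrib, Finset.card_filter]
  push_cast
  refine Finset.sum_congr rfl fun i _ => ?_
  by_cases a : IsolatedIn h' Set.univ x v i
  · have : IsolatedIn h Set.univ x v i := fun k hk hkB =>
      (hle _ (norm_nonneg _)).trans (a k hk hkB)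
    simp [isoInd, a, this]
  · by_cases b : IsolatedIn h Set.univ x v i <;> simp [isoInd, a, b]

/-- The integrand of the second factorial moment of the number of vertices isolated for `h` but
not for `h'`. -/
noncomputable def lostPairDensity (lam : ℝ) (h h' : ℝ → ℝ) (x y : E d) : ℝ :=
  (1 - h ‖x - y‖) * (p d lam h * p d lam h * pp lam h h x y)
    - 2 * ((1 - h' ‖x - y‖) * (p d lam h * p d lam h' * pp lam h h' x y))
    + (1 - h' ‖x - y‖) * (p d lam h' * p d lam h' * pp lam h' h' x y)

lemma measurable_pp (hh : IsProfile d h) (hh' : IsProfile d h') :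
    Measurable (fun q : E d × E d => pp lam h h' q.1 q.2) := by
  refine Real.measurable_exp.comp (measurable_const.mul ?_)
  have : Measurable (fun w : (E d × E d) × E d => h ‖w.2 - w.1.1‖ * h' ‖w.2 - w.1.2‖) :=
    (hh.measurable_norm.comp (measurable_snd.sub measurable_fst.fst)).mul
      (hh'.measurable_norm.comp (measurable_snd.sub measurable_fst.snd))
  exact this.stronglyMeasurable.integral_prod_right'.measurable

/-- The integrand of `integral_isoPairs`, which is the joint isolation probability of two points
at `x` and `y`, is integrable on `K × K`. -/
lemma integrable_pair_prob (hlam : 0 ≤ lam) (hh : IsProfile d h) (hh' : IsProfile d h')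
    (hK : volume K ≠ ⊤) :
    Integrable (fun q : E d × E d => (1 - h' ‖q.1 - q.2‖) *
      (p d lam h * p d lam h' * pp lam h h' q.1 q.2))
      ((volume.restrict K).prod (volume.restrict K)) := by
  have hfin : IsFiniteMeasure (volume.restrict K) := ⟨by simpa using hK.lt_top⟩
  refine (integrable_const (1 : ℝ)).mono' ?_ (ae_of_all _ fun q => ?_)
  · exact ((measurable_const.sub hh'.measurable_sub).mul
      (measurable_const.mul (measurable_pp hh hh'))).aestronglyMeasurable
  · rw [← exp_pair_eq hh hh', norm_mul, Real.norm_eq_abs (1 - h' ‖q.1 - q.2‖),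
      abs_of_nonneg (hh'.sub_mem_Icc q.1 q.2).1, ← setIntegral_univ]
    refine mul_le_one₀ (hh'.sub_mem_Icc _ _).2 (norm_nonneg _)
      (exp_neg_mul_setIntegral_le_one hlam fun z => ?_)
    have h1 := hh.sub_mem_Icc q.1 z
    have h2 := hh'.sub_mem_Icc q.2 z
    linarith [mul_le_one₀ h1.2 h2.1 h2.2]

lemma setIntegral_lostPairDensity (hlam : 0 ≤ lam) (hh : IsProfile d h) (hh' : IsProfile d h')
    (hK : volume K ≠ ⊤) :
    Integrable (fun q : E d × E d => lostPairDensity lam h h' q.1 q.2)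
      ((volume.restrict K).prod (volume.restrict K)) ∧
    ∫ x in K, ∫ y in K, lostPairDensity lam h h' x y =
      (∫ x in K, ∫ y in K, (1 - h ‖x - y‖) * (p d lam h * p d lam h * pp lam h h x y))
      - 2 * (∫ x in K, ∫ y in K, (1 - h' ‖x - y‖) * (p d lam h * p d lam h' * pp lam h h' x y))
      + ∫ x in K, ∫ y in K, (1 - h' ‖x - y‖) * (p d lam h' * p d lam h' * pp lam h' h' x y) := by
  have hfin : IsFiniteMeasure (volume.restrict K) := ⟨by simpa using hK.lt_top⟩
  have i1 := integrable_pair_prob (lam := lam) hlam hh hh hK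
  have i2 := integrable_pair_prob (lam := lam) hlam hh hh' hK
  have i3 := integrable_pair_prob (lam := lam) hlam hh' hh' hK
  have i4 : Integrable (fun q : E d × E d => lostPairDensity lam h h' q.1 q.2)
      ((volume.restrict K).prod (volume.restrict K)) := (i1.sub (i2.const_mul 2)).add i3
  refine ⟨i4, ?_⟩
  rw [integral_integral i4, integral_integral i1, integral_integral i2, integral_integral i3]
  simp only [lostPairDensity]
  exact integral_sub_two_mul_add i1 i2 i3

/-- The first two moments of the number of vertices in `K` that are isolated for `h` but not for
the larger function `h'`. -/
lemma IsMarkedPoissonProcess.moments_lostIsolated [IsProbabilityMeasure P]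
    (hX : IsMarkedPoissonProcess P lam ξ u) (hlam : 0 ≤ lam) (hd : 1 ≤ d) (hh : IsProfile d h)
    (hh' : IsProfile d h') (hle : ∀ r, 0 ≤ r → h r ≤ h' r)
    (hK : MeasurableSet K) (hKb : Bornology.IsBounded K) (hKf : volume (frontier K) = 0) :
    (∀ᵐ ω ∂P, (lostIsolated K h h' (fun i => ξ i ω) (fun e => u e ω)).Finite) ∧
    MemLp (fun ω => ((lostIsolated K h h' (fun i => ξ i ω) (fun e => u e ω)).ncard : ℝ)) 2 P ∧
    ∫ ω, ((lostIsolated K h h' (fun i => ξ i ω) (fun e => u e ω)).ncard : ℝ) ∂P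
      = lam * volume.real K * (p d lam h - p d lam h') ∧
    ∫ ω, ((lostIsolated K h h' (fun i => ξ i ω) (fun e => u e ω)).ncard : ℝ) ^ 2 ∂P
      = lam * volume.real K * (p d lam h - p d lam h') +
        lam ^ 2 * ∫ x in K, ∫ y in K, lostPairDensity lam h h' x y := by
  have hK' : volume K ≠ ⊤ := hKb.measure_lt_top.ne
  have hfin := hX.poisson.ae_finite hK hK'
  set C : Ω → ℝ := fun ω => isoCount h Set.univ K (fun i => ξ i ω) (fun e => u e ω) with hC
  set C' : Ω → ℝ := fun ω => isoCount h' Set.univ K (fun i => ξ i ω) (fun e => u e ω) with hC'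
  have hL : (fun ω => ((lostIsolated K h h' (fun i => ξ i ω) (fun e => u e ω)).ncard : ℝ))
      =ᵐ[P] fun ω => C ω - C' ω := by
    filter_upwards [hfin] with ω hω using ncard_lostIsolated_eq hle hω
  obtain ⟨mC, eC⟩ := hX.integral_isoCount hlam hd hh hK hKb hKf
  obtain ⟨mC', eC'⟩ := hX.integral_isoCount hlam hd hh' hK hKb hKf
  obtain ⟨m11, e11⟩ := hX.integral_isoPairs hlam hd hh hh (fun _ _ => le_rfl) hK hKb hKf
  obtain ⟨m12, e12⟩ := hX.integral_isoPairs hlam hd hh hh' hle hK hKb hKf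
  obtain ⟨m22, e22⟩ := hX.integral_isoPairs hlam hd hh' hh' (fun _ _ => le_rfl) hK hKb hKf
  have hsq := hX.poisson.integrable_card_sq hK hK'
  have iC : ∀ {k : ℝ → ℝ}, AEStronglyMeasurable
      (fun ω => isoCount k Set.univ K (fun i => ξ i ω) (fun e => u e ω)) P →
      Integrable (fun ω => isoCount k Set.univ K (fun i => ξ i ω) (fun e => u e ω)) P :=
    fun hm => hsq.mono' hm (ae_of_all _ fun ω => by
      rw [Real.norm_eq_abs, abs_of_nonneg isoCount_nonneg]; exact isoCount_le)
  have iP : ∀ {k k' : ℝ → ℝ}, AEStronglyMeasurable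
      (fun ω => isoPairs k k' Set.univ K (fun i => ξ i ω) (fun e => u e ω)) P →
      Integrable (fun ω => isoPairs k k' Set.univ K (fun i => ξ i ω) (fun e => u e ω)) P :=
    fun hm => hsq.mono' hm (ae_of_all _ fun ω => by
      rw [Real.norm_eq_abs, abs_of_nonneg isoPairs_nonneg]; exact isoPairs_le)
  have hpt : ∀ ω, (C ω - C' ω) ^ 2 = C ω - C' ω +
      (isoPairs h h Set.univ K (fun i => ξ i ω) (fun e => u e ω)
      - 2 * isoPairs h h' Set.univ K (fun i => ξ i ω) (fun e => u e ω)
      + isoPairs h' h' Set.univ K (fun i => ξ i ω) (fun e => u e ω)) := by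
    intro ω
    have a1 := isoCount_mul_isoCount (K := K) (B := Set.univ) (x := fun i => ξ i ω)
      (v := fun e => u e ω) (h := h) (h' := h) (fun _ _ => le_rfl)
    have a2 := isoCount_mul_isoCount (K := K) (B := Set.univ) (x := fun i => ξ i ω)
      (v := fun e => u e ω) hle
    have a3 := isoCount_mul_isoCount (K := K) (B := Set.univ) (x := fun i => ξ i ω)
      (v := fun e => u e ω) (h := h') (h' := h') (fun _ _ => le_rfl)
    simp only [hC, hC']
    linear_combination a1 - 2 * a2 + a3
  have isq : Integrable (fun ω => (C ω - C' ω) ^ 2) P := by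
    simp only [hpt]
    exact ((iC mC).sub (iC mC')).add (((iP m11).sub ((iP m12).const_mul 2)).add (iP m22))
  refine ⟨?_, ?_, ?_, ?_⟩
  · filter_upwards [hfin] with ω hω
    exact hω.subset fun i hi => hi.1
  · refine MemLp.ae_eq hL.symm ?_
    exact (memLp_two_iff_integrable_sq (mC.sub mC')).mpr isq
  · rw [integral_congr_ae hL, integral_sub (iC mC) (iC mC'), eC, eC']
    ring
  · have : ∫ ω, ((lostIsolated K h h' (fun i => ξ i ω) (fun e => u e ω)).ncard : ℝ) ^ 2 ∂P
        = ∫ ω, (C ω - C' ω) ^ 2 ∂P := by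
      refine integral_congr_ae ?_
      filter_upwards [hL] with ω hω
      rw [hω]
    rw [this]
    simp only [hpt]
    have hs : Integrable (fun ω => C ω - C' ω) P := (iC mC).sub (iC mC')
    have hq : Integrable (fun ω => isoPairs h h Set.univ K (fun i => ξ i ω) (fun e => u e ω)
        - 2 * isoPairs h h' Set.univ K (fun i => ξ i ω) (fun e => u e ω)
        + isoPairs h' h' Set.univ K (fun i => ξ i ω) (fun e => u e ω)) P :=
      ((iP m11).sub ((iP m12).const_mul 2)).add (iP m22)
    rw [integral_add hs hq, integral_sub (iC mC) (iC mC'),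
      integral_sub_two_mul_add (iP m11) (iP m12) (iP m22), eC, eC', e11, e12, e22,
      (setIntegral_lostPairDensity hlam hh hh' hK').2]
    ring

end RandomConnection

namespace RandomConnection

variable {d : ℕ} {lam : ℝ} {g h h' : ℝ → ℝ} {K : Set (E d)} {R : ℝ}

/-! ### Truncation and scaling of connection functions -/

lemma IsConnectionFunction.isProfile (hg : IsConnectionFunction d g) : IsProfile d g :=
  ⟨hg.mem_Icc, hg.antitoneOn, hg.integrable⟩

lemma IsProfile.truncBelow_le (hh : IsProfile d h) {r : ℝ} (hr : 0 ≤ r) :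
    truncBelow R h r ≤ h r := by
  unfold truncBelow
  split_ifs
  exacts [le_rfl, (hh.mem_Icc r hr).1]

lemma IsProfile.truncBelow (hh : IsProfile d h) (R : ℝ) :
    IsProfile d (truncBelow R h) := by
  have h0 : ∀ r, 0 ≤ r → RandomConnection.truncBelow R h r ∈ Set.Icc (0 : ℝ) 1 := by
    intro r hr
    unfold RandomConnection.truncBelow
    split_ifs
    exacts [hh.mem_Icc r hr, by simp]
  refine ⟨h0, ?_, ?_⟩
  · intro a ha b hb hab
    unfold RandomConnection.truncBelow
    split_ifs with h1 h2 h3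
    · exact hh.antitoneOn ha hb hab
    · exact absurd (hab.trans h1) h2
    · exact (hh.mem_Icc a ha).1
    · exact le_rfl
  · have hm : Measurable (fun y : E d => RandomConnection.truncBelow R h ‖y‖) :=
      Measurable.ite (measurableSet_le _root_.measurable_norm measurable_const)
        hh.measurable_norm measurable_const
    refine hh.integrable.mono' hm.aestronglyMeasurable (ae_of_all _ fun y => ?_)
    rw [Real.norm_eq_abs, abs_of_nonneg (h0 _ (norm_nonneg y)).1]
    exact hh.truncBelow_le (norm_nonneg y)

lemma truncAbove_eq (r : ℝ) : truncAbove R h r = h r - truncBelow R h r := by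
  unfold truncAbove truncBelow
  by_cases hr : r ≤ R
  · simp [hr, not_lt.mpr hr]
  · simp [hr, not_le.mp hr]

lemma IsProfile.integrable_truncAbove (hh : IsProfile d h) :
    Integrable (fun y : E d => truncAbove R h ‖y‖) := by
  simp only [truncAbove_eq]
  exact hh.integrable.sub (hh.truncBelow R).integrable

lemma p_eq_mul_p_truncAbove (hh : IsProfile d h) (R : ℝ) :
    p d lam h = p d lam (truncBelow R h) * p d lam (truncAbove R h) := by
  unfold p
  simp only [truncAbove_eq]
  rw [integral_sub hh.integrable (hh.truncBelow R).integrable, ← Real.exp_add]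
  ring_nf

lemma norm_natCast_smul (n : ℕ) (y : E d) : ‖(n : ℝ) • y‖ = n * ‖y‖ := by
  rw [norm_smul, Real.norm_natCast]

lemma integral_natCast_smul (n : ℕ) (f : E d → ℝ) :
    ∫ y, f ((n : ℝ) • y) = ((n : ℝ) ^ d)⁻¹ * ∫ y, f y := by
  rw [Measure.integral_comp_smul, finrank_euclideanSpace_fin, abs_of_nonneg (by positivity),
    smul_eq_mul]

lemma IsProfile.scale (hh : IsProfile d h) {n : ℕ} (hn : 1 ≤ n) : IsProfile d (scale n h) := by
  have hn0 : (0 : ℝ) ≤ n := Nat.cast_nonneg n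
  refine ⟨fun r hr => hh.mem_Icc _ (mul_nonneg hn0 hr), fun a ha b hb hab =>
    hh.antitoneOn (mul_nonneg hn0 ha) (mul_nonneg hn0 hb) (mul_le_mul_of_nonneg_left hab hn0), ?_⟩
  have := hh.integrable.comp_smul (R := (n : ℝ)) (Nat.cast_ne_zero.mpr (by lia))
  simp only [norm_natCast_smul] at this
  exact this

lemma truncBelow_scale {n : ℕ} (hn : 1 ≤ n) :
    truncBelow (R / n) (scale n h) = scale n (truncBelow R h) := by
  have hn0 : (0 : ℝ) < n := by exact_mod_cast hn
  ext r
  simp only [truncBelow, scale, le_div_iff₀' hn0]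

lemma p_scale (n : ℕ) : p d lam (scale n h) = p d (lam / (n : ℝ) ^ d) h := by
  have := integral_natCast_smul (d := d) n (fun y => h ‖y‖)
  simp only [norm_natCast_smul] at this
  simp only [p, scale, this]
  ring_nf

lemma pp_scale (n : ℕ) (x y : E d) :
    pp lam (scale n h) (scale n h') x y
      = pp (lam / (n : ℝ) ^ d) h h' ((n : ℝ) • (x - y)) 0 := by
  have h1 := integral_natCast_smul (d := d) n
    (fun v => h ‖v - (n : ℝ) • (x - y)‖ * h' ‖v - 0‖)
  have h2 : ∀ z : E d, h (n * ‖z - x‖) * h' (n * ‖z - y‖) =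
      (fun z => h ‖(n : ℝ) • z - (n : ℝ) • (x - y)‖ * h' ‖(n : ℝ) • z - 0‖) (z - y) := by
    intro z
    simp only [← smul_sub, sub_zero, norm_natCast_smul]
    congr 4
    abel
  simp only [pp, scale, h2]
  rw [integral_sub_right_eq_self (fun z => h ‖(n : ℝ) • z - (n : ℝ) • (x - y)‖ *
    h' ‖(n : ℝ) • z - 0‖), h1]
  ring_nf

lemma lostPairDensity_scale (n : ℕ) (x y : E d) :
    lostPairDensity lam (scale n h) (scale n h') x y
      = lostPairDensity (lam / (n : ℝ) ^ d) h h' ((n : ℝ) • (x - y)) 0 := by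
  simp only [lostPairDensity, p_scale, pp_scale, scale, sub_zero, norm_natCast_smul]

/-! ### The covariance density -/

/-- The covariance density: the second factorial moment density of the vertices isolated for `h`
but not for `h'`, at the points `w` and `0`, minus the square of the density of such vertices. -/
noncomputable def covDensity (μ : ℝ) (h h' : ℝ → ℝ) (w : E d) : ℝ :=
  lostPairDensity μ h h' w 0 - (p d μ h - p d μ h') ^ 2

lemma measurable_covDensity (hh : IsProfile d h) (hh' : IsProfile d h') :
    Measurable (fun w : E d => covDensity lam h h' w) := by
  have hq : ∀ {k k' : ℝ → ℝ}, IsProfile d k → IsProfile d k' → Measurable (fun w : E d =>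
      (1 - k' ‖w - 0‖) * (p d lam k * p d lam k' * pp lam k k' w 0)) := by
    intro k k' hk hk'
    have h1 : Measurable (fun w : E d => k' ‖w - 0‖) :=
      hk'.measurable_norm.comp (measurable_id.sub_const 0)
    have h0 : Measurable (fun w : E d => (w, (0 : E d))) := measurable_id.prodMk measurable_const
    have h2 := (measurable_pp (lam := lam) hk hk').comp h0
    exact (h1.const_sub 1).mul (h2.const_mul _)
  unfold covDensity lostPairDensity
  exact (((hq hh hh).sub ((hq hh hh').const_mul 2)).add (hq hh' hh')).sub_const _

/-- The overlap integral `∫ h(|v - w|) h(|v|) dv`. -/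
noncomputable def overlap (h : ℝ → ℝ) (w : E d) : ℝ := ∫ v : E d, h ‖v - w‖ * h ‖v‖

/-- The overlap integral is a convolution of `h(|·|)` with itself. -/
lemma integrable_overlap (hh : IsProfile d h) : Integrable (fun w : E d => overlap h w) := by
  have := hh.integrable.integrable_convolution (ContinuousLinearMap.mul ℝ ℝ) hh.integrable
  refine this.congr (ae_of_all _ fun w => ?_)
  simp only [convolution, ContinuousLinearMap.mul_apply', overlap]
  refine integral_congr_ae (ae_of_all _ fun v => ?_)
  simp only [norm_sub_rev w v, mul_comm]

lemma IsProfile.integrable_overlap_integrand (hh : IsProfile d h) (hh' : IsProfile d h')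
    (w : E d) : Integrable (fun v : E d => h ‖v - w‖ * h' ‖v‖) := by
  have := hh.integrable_mul hh' w 0
  simpa only [norm_sub_rev w, zero_sub, norm_neg] using this

lemma overlap_le (hh : IsProfile d h) (w : E d) : overlap h w ≤ ∫ v : E d, h ‖v‖ :=
  integral_mono (hh.integrable_overlap_integrand hh w) hh.integrable fun _ =>
    mul_le_of_le_one_left (hh.nonneg _) (hh.le_one _)

/-- The bound for one of the terms of the covariance density: the isolation probabilities of two
points differ from being independent only through the direct connection and the overlap. -/
lemma abs_pair_term_le {M μ : ℝ} (hμ : 0 ≤ μ) (hμM : μ ≤ M) {k k' : ℝ → ℝ} (hg : IsProfile d g)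
    (hk : IsProfile d k) (hk' : IsProfile d k') (hkg : ∀ r, 0 ≤ r → k r ≤ g r)
    (hkg' : ∀ r, 0 ≤ r → k' r ≤ g r) (w : E d) :
    |(1 - k' ‖w - 0‖) * (p d μ k * p d μ k' * pp μ k k' w 0) - p d μ k * p d μ k'|
      ≤ Real.exp (M * ∫ v : E d, g ‖v‖) * (M * overlap g w + g ‖w‖) := by
  set t : ℝ := ∫ v : E d, k ‖v - w‖ * k' ‖v - 0‖ with ht
  have ht0 : 0 ≤ t := integral_nonneg fun v => mul_nonneg (hk.nonneg _) (hk'.nonneg _)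
  have htc : t ≤ overlap g w := by
    simp only [ht, sub_zero]
    exact integral_mono (hk.integrable_overlap_integrand hk' w)
      (hg.integrable_overlap_integrand hg w) fun v =>
      mul_le_mul (hkg _ (norm_nonneg _)) (hkg' _ (norm_nonneg _)) (hk'.nonneg _) (hg.nonneg _)
  have hcI := overlap_le hg w
  set C := Real.exp (M * ∫ v : E d, g ‖v‖)
  have hpp : pp μ k k' w 0 = Real.exp (μ * t) := rfl
  have hM : 0 ≤ M := hμ.trans hμM
  have hμt : μ * t ≤ M * overlap g w := mul_le_mul hμM htc ht0 hM
  have hC : Real.exp (μ * t) ≤ C :=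
    Real.exp_le_exp.mpr (hμt.trans (mul_le_mul_of_nonneg_left hcI hM))
  have hp1 : ∀ {k : ℝ → ℝ}, IsProfile d k → 0 ≤ p d μ k ∧ p d μ k ≤ 1 := by
    intro k hk
    refine ⟨(Real.exp_pos _).le, Real.exp_le_one_iff.mpr ?_⟩
    have : 0 ≤ ∫ y : E d, k ‖y‖ := integral_nonneg fun y => hk.nonneg y
    nlinarith
  have hq0 : 0 ≤ p d μ k * p d μ k' := mul_nonneg (hp1 hk).1 (hp1 hk').1
  have hq1 : p d μ k * p d μ k' ≤ 1 := mul_le_one₀ (hp1 hk).2 (hp1 hk').1 (hp1 hk').2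
  have e1 : 0 ≤ Real.exp (μ * t) - 1 := by
    have := Real.add_one_le_exp (μ * t)
    have := mul_nonneg hμ ht0
    linarith
  -- `e^s - 1 ≤ s e^s`
  have e2 : Real.exp (μ * t) - 1 ≤ μ * t * Real.exp (μ * t) := by
    have h1 := Real.add_one_le_exp (-(μ * t))
    have h2 : Real.exp (-(μ * t)) * Real.exp (μ * t) = 1 := by rw [← Real.exp_add]; simp
    nlinarith [Real.exp_pos (μ * t)]
  have e3 : μ * t * Real.exp (μ * t) ≤ M * overlap g w * C :=
    mul_le_mul hμt hC (Real.exp_pos _).le (mul_nonneg hM (ht0.trans htc))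
  have hk'0 := hk'.nonneg w
  have hk'g := hkg' _ (norm_nonneg w)
  have e4 : k' ‖w‖ * Real.exp (μ * t) ≤ g ‖w‖ * C :=
    mul_le_mul hk'g hC (Real.exp_pos _).le (hk'0.trans hk'g)
  have e5 : 0 ≤ k' ‖w‖ * Real.exp (μ * t) := mul_nonneg hk'0 (Real.exp_pos _).le
  have hsplit : (1 - k' ‖w - 0‖) * (p d μ k * p d μ k' * pp μ k k' w 0) - p d μ k * p d μ k'
      = p d μ k * p d μ k' * ((Real.exp (μ * t) - 1) - k' ‖w‖ * Real.exp (μ * t)) := by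
    rw [hpp, sub_zero]; ring
  rw [hsplit, abs_mul, abs_of_nonneg hq0]
  refine (mul_le_of_le_one_left (abs_nonneg _) hq1).trans ?_
  rw [abs_le]
  constructor <;> nlinarith

lemma abs_covDensity_le {M μ : ℝ} (hμ : 0 ≤ μ) (hμM : μ ≤ M) (hh : IsProfile d h)
    (hh' : IsProfile d h') (hle : ∀ r, 0 ≤ r → h r ≤ h' r) (w : E d) :
    |covDensity μ h h' w|
      ≤ 4 * (Real.exp (M * ∫ v : E d, h' ‖v‖) * (M * overlap h' w + h' ‖w‖)) := by
  have a1 := abs_pair_term_le hμ hμM hh' hh hh hle hle w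
  have a2 := abs_pair_term_le hμ hμM hh' hh hh' hle (fun _ _ => le_rfl) w
  have a3 := abs_pair_term_le hμ hμM hh' hh' hh' (fun _ _ => le_rfl) (fun _ _ => le_rfl) w
  have e : covDensity μ h h' w
      = ((1 - h ‖w - 0‖) * (p d μ h * p d μ h * pp μ h h w 0) - p d μ h * p d μ h)
      - 2 * ((1 - h' ‖w - 0‖) * (p d μ h * p d μ h' * pp μ h h' w 0) - p d μ h * p d μ h')
      + ((1 - h' ‖w - 0‖) * (p d μ h' * p d μ h' * pp μ h' h' w 0) - p d μ h' * p d μ h') := by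
    unfold covDensity lostPairDensity; ring
  rw [abs_le] at *
  rw [e]
  constructor <;> linarith [a1.1, a1.2, a2.1, a2.2, a3.1, a3.2]

lemma integrable_covDensity_bound (hh' : IsProfile d h') (M : ℝ) :
    Integrable (fun w : E d =>
      4 * (Real.exp (M * ∫ v : E d, h' ‖v‖) * (M * overlap h' w + h' ‖w‖))) :=
  ((((integrable_overlap hh').const_mul M).add hh'.integrable).const_mul _).const_mul 4

lemma integrable_covDensity (hlam : 0 ≤ lam) (hh : IsProfile d h)
    (hh' : IsProfile d h') (hle : ∀ r, 0 ≤ r → h r ≤ h' r) :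
    Integrable (fun w : E d => covDensity lam h h' w) :=
  (integrable_covDensity_bound hh' lam).mono' (measurable_covDensity hh hh').aestronglyMeasurable
    (ae_of_all _ fun w => abs_covDensity_le hlam le_rfl hh hh' hle w)

lemma continuous_p (h : ℝ → ℝ) : Continuous (fun μ => p d μ h) := by
  unfold p; fun_prop

lemma continuous_covDensity (h h' : ℝ → ℝ) (w : E d) :
    Continuous (fun μ => covDensity μ h h' w) := by
  unfold covDensity lostPairDensity p pp; fun_prop

/-- Substituting `w = n (x - y)` in the inner integral. -/
lemma setIntegral_comp_smul_sub (hK : MeasurableSet K) {n : ℕ} (hn : 1 ≤ n) (f : E d → ℝ)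
    (x : E d) :
    ∫ y in K, f ((n : ℝ) • (x - y))
      = ((n : ℝ) ^ d)⁻¹ * ∫ w, K.indicator (fun _ => (1 : ℝ)) (x - (n : ℝ)⁻¹ • w) * f w := by
  have hn0 : (n : ℝ) ≠ 0 := Nat.cast_ne_zero.mpr (by lia)
  rw [← integral_natCast_smul n
    (fun w => K.indicator (fun _ => (1 : ℝ)) (x - (n : ℝ)⁻¹ • w) * f w),
    ← integral_sub_left_eq_self (fun y => K.indicator (fun _ => (1 : ℝ))
      (x - (n : ℝ)⁻¹ • (n : ℝ) • y) * f ((n : ℝ) • y)) volume x, ← integral_indicator hK]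
  refine integral_congr_ae (ae_of_all _ fun y => ?_)
  simp only [smul_smul, inv_mul_cancel₀ hn0, one_smul, sub_sub_cancel]
  by_cases hy : y ∈ K <;> simp [hy]

/-- Seen from almost every point of `K`, at scale `1 / n` the set `K` fills the space. -/
lemma tendsto_setIntegral_covDensity (hlam : 0 < lam) (hh : IsProfile d h)
    (hh' : IsProfile d h') (hle : ∀ r, 0 ≤ r → h r ≤ h' r) (hK : MeasurableSet K)
    (hKb : Bornology.IsBounded K) (hKf : volume (frontier K) = 0) {μ : ℕ → ℝ}
    (hμ : Tendsto μ atTop (𝓝 lam)) :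
    Tendsto (fun n : ℕ => ∫ x in K, ∫ w, K.indicator (fun _ => (1 : ℝ)) (x - (n : ℝ)⁻¹ • w) *
        covDensity (μ n) h h' w) atTop
      (𝓝 (volume.real K * ∫ w : E d, covDensity lam h h' w)) := by
  have hK' : volume K ≠ ⊤ := hKb.measure_lt_top.ne
  have hfin : IsFiniteMeasure (volume.restrict K) := ⟨by simpa using hK'.lt_top⟩
  set b : E d → ℝ := fun w =>
    4 * (Real.exp ((lam + 1) * ∫ v : E d, h' ‖v‖) * ((lam + 1) * overlap h' w + h' ‖w‖)) with hb
  have hbi : Integrable b := integrable_covDensity_bound hh' (lam + 1)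
  have hev : ∀ᶠ n : ℕ in atTop, 0 ≤ μ n ∧ μ n ≤ lam + 1 :=
    (hμ.eventually (lt_mem_nhds hlam)).and (hμ.eventually (gt_mem_nhds (lt_add_one lam)))
      |>.mono fun n hn => ⟨hn.1.le, hn.2.le⟩
  have hbound : ∀ᶠ n : ℕ in atTop, ∀ x w : E d,
      ‖K.indicator (fun _ => (1 : ℝ)) (x - (n : ℝ)⁻¹ • w) * covDensity (μ n) h h' w‖ ≤ b w := by
    filter_upwards [hev] with n hn x w
    rw [norm_mul, Real.norm_eq_abs, Real.norm_eq_abs, abs_of_nonneg (indicator_one_mem K _).1]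
    exact (mul_le_of_le_one_left (abs_nonneg _) (indicator_one_mem K _).2).trans
      (abs_covDensity_le hn.1 hn.2 hh hh' hle w)
  have hmeas : ∀ n : ℕ, Measurable (fun q : E d × E d =>
      K.indicator (fun _ => (1 : ℝ)) (q.1 - (n : ℝ)⁻¹ • q.2) * covDensity (μ n) h h' q.2) := by
    intro n
    have h1 : Measurable (K.indicator fun _ => (1 : ℝ)) := measurable_const.indicator hK
    have h2 : Measurable (fun q : E d × E d => q.1 - (n : ℝ)⁻¹ • q.2) :=
      measurable_fst.sub (measurable_snd.const_smul (n : ℝ)⁻¹)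
    have h3 : Measurable (fun w : E d => covDensity (μ n) h h' w) := measurable_covDensity hh hh'
    exact (h1.comp h2).mul (h3.comp measurable_snd)
  have hlimit : volume.real K * ∫ w : E d, covDensity lam h h' w
      = ∫ x in K, ∫ w : E d, covDensity lam h h' w := by simp
  rw [hlimit]
  refine tendsto_integral_filter_of_dominated_convergence (fun _ => ∫ w, b w)
    (Eventually.of_forall fun n =>
      (hmeas n).stronglyMeasurable.integral_prod_right'.aestronglyMeasurable)
    ?_ (integrable_const _) ?_
  · filter_upwards [hbound] with n hn
    exact ae_of_all _ fun x => norm_integral_le_of_norm_le hbi (ae_of_all _ (hn x))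
  · have hint : ∀ᵐ x : E d, x ∉ frontier K := by rw [ae_iff]; simpa using hKf
    filter_upwards [ae_restrict_of_ae hint, ae_restrict_mem hK] with x hx hxK
    have hxi : x ∈ interior K := by
      by_contra hxi
      exact hx ⟨subset_closure hxK, hxi⟩
    refine tendsto_integral_filter_of_dominated_convergence b
      (Eventually.of_forall fun n => ((hmeas n).comp measurable_prodMk_left).aestronglyMeasurable)
      (hbound.mono fun n hn => ae_of_all _ (hn x)) hbi (ae_of_all _ fun w => ?_)
    have h1 : Tendsto (fun n => covDensity (μ n) h h' w) atTop (𝓝 (covDensity lam h h' w)) :=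
      ((continuous_covDensity h h' w).tendsto lam).comp hμ
    have h2 : Tendsto (fun n : ℕ => x - (n : ℝ)⁻¹ • w) atTop (𝓝 x) := by
      have := (tendsto_inv_atTop_nhds_zero_nat (𝕜 := ℝ)).smul_const w
      simpa using this.const_sub x
    refine h1.congr' ?_
    filter_upwards [h2.eventually (isOpen_interior.mem_nhds hxi)] with n hn
    rw [Set.indicator_of_mem (interior_subset hn), one_mul]

/-! ### The limit of the variance -/

/-- The two integrands of the limit add up to the covariance density, because
`1 - g_R = (1 - g) + g^R` and `p(λ,g) = p(λ,g_R) p(λ,g^R)`. -/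
lemma varIntegrand_add_extraIntegrand (hg : IsProfile d g) (x : E d) :
    varIntegrand lam g R x + p d lam (truncBelow R g) ^ 2 * extraIntegrand lam g R x
      = covDensity lam (truncBelow R g) g x := by
  simp only [varIntegrand, extraIntegrand, covDensity, lostPairDensity, sub_zero, truncAbove_eq,
    p_eq_mul_p_truncAbove hg R]
  ring

lemma integrable_extraIntegrand (hlam : 0 ≤ lam) (hg : IsProfile d g) :
    Integrable (fun x : E d => extraIntegrand lam g R x) := by
  have hR := hg.truncBelow R
  refine (hg.integrable_truncAbove (R := R)).mul_bdd
    (c := Real.exp (lam * ∫ v : E d, g ‖v‖)) ?_ (ae_of_all _ fun x => ?_)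
  · exact ((measurable_pp hR hR).comp (measurable_id.prodMk measurable_const)).aestronglyMeasurable
  · rw [pp, Real.norm_eq_abs, abs_of_pos (Real.exp_pos _), Real.exp_le_exp]
    refine mul_le_mul_of_nonneg_left ?_ hlam
    simp only [sub_zero]
    exact integral_mono (hR.integrable_overlap_integrand hR x) hg.integrable fun v =>
      (mul_le_of_le_one_left (hR.nonneg _) (hR.le_one _)).trans (hg.truncBelow_le (norm_nonneg _))

lemma integrable_varIntegrand (hlam : 0 ≤ lam) (hg : IsProfile d g) :
    Integrable (fun x : E d => varIntegrand lam g R x) := by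
  have h1 : (fun x : E d => varIntegrand lam g R x) = fun x =>
      covDensity lam (truncBelow R g) g x
        - p d lam (truncBelow R g) ^ 2 * extraIntegrand lam g R x := by
    ext x
    rw [← varIntegrand_add_extraIntegrand hg]
    ring
  rw [h1]
  exact (integrable_covDensity hlam (hg.truncBelow R) hg fun _ hr => hg.truncBelow_le hr).sub
    ((integrable_extraIntegrand hlam hg).const_mul _)

lemma integral_covDensity (hlam : 0 ≤ lam) (hg : IsProfile d g) :
    ∫ x : E d, covDensity lam (truncBelow R g) g x
      = (∫ x : E d, varIntegrand lam g R x)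
        + p d lam (truncBelow R g) ^ 2 * ∫ x : E d, extraIntegrand lam g R x := by
  simp only [← varIntegrand_add_extraIntegrand hg]
  rw [integral_add (integrable_varIntegrand hlam hg)
    ((integrable_extraIntegrand hlam hg).const_mul _), integral_const_mul]

/-- The moments of `L_{R,n}(g)`, rescaled to unit length. -/
lemma moments_L {Ω : Type*} [MeasurableSpace Ω] {P : Measure Ω} [IsProbabilityMeasure P]
    {ξ : ℕ → Ω → E d} {u : Sym2 ℕ → Ω → ℝ} (hX : IsMarkedPoissonProcess P lam ξ u)
    (hlam : 0 ≤ lam) (hd : 1 ≤ d) (hg : IsProfile d g) (hK : MeasurableSet K)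
    (hKb : Bornology.IsBounded K) (hKf : volume (frontier K) = 0) (R : ℝ) {n : ℕ} (hn : 1 ≤ n) :
    (∀ᵐ ω ∂P, (setL K g R n (fun i => ξ i ω) (fun e => u e ω)).Finite) ∧
    MemLp (L K g R n ξ u) 2 P ∧
    ∫ ω, L K g R n ξ u ω ∂P = lam * volume.real K *
      (p d (lam / (n : ℝ) ^ d) (truncBelow R g) - p d (lam / (n : ℝ) ^ d) g) ∧
    variance (L K g R n ξ u) P = lam * volume.real K *
        (p d (lam / (n : ℝ) ^ d) (truncBelow R g) - p d (lam / (n : ℝ) ^ d) g)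
      + lam ^ 2 * (((n : ℝ) ^ d)⁻¹ * ∫ x in K, ∫ w,
          K.indicator (fun _ => (1 : ℝ)) (x - (n : ℝ)⁻¹ • w) *
          covDensity (lam / (n : ℝ) ^ d) (truncBelow R g) g w) := by
  have hK' : volume K ≠ ⊤ := hKb.measure_lt_top.ne
  have hfin : IsFiniteMeasure (volume.restrict K) := ⟨by simpa using hK'.lt_top⟩
  have hR := hg.truncBelow R
  have hle : ∀ r, 0 ≤ r → scale n (truncBelow R g) r ≤ scale n g r := fun r hr =>
    hg.truncBelow_le (mul_nonneg (Nat.cast_nonneg n) hr)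
  have hL : L K g R n ξ u = fun ω => ((lostIsolated K (scale n (truncBelow R g)) (scale n g)
      (fun i => ξ i ω) (fun e => u e ω)).ncard : ℝ) := by
    ext ω
    rw [L, setL, truncBelow_scale hn]
  obtain ⟨h1, h2, h3, h4⟩ := hX.moments_lostIsolated hlam hd (hR.scale hn) (hg.scale hn) hle
    hK hKb hKf
  have hi := (setIntegral_lostPairDensity hlam (hR.scale hn) (hg.scale hn) hK').1
  rw [hL]
  simp only [setL, truncBelow_scale hn]
  refine ⟨h1, h2, by rw [h3, p_scale, p_scale], ?_⟩
  rw [variance_eq_sub h2]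
  simp only [Pi.pow_apply]
  rw [h3, h4, p_scale, p_scale]
  set μ := lam / (n : ℝ) ^ d with hμ
  set m := p d μ (truncBelow R g) - p d μ g with hm
  -- subtracting the squared mean density under the integral makes the integrand integrable in `w`
  have hcov : ∫ x in K, ∫ y in K, covDensity μ (truncBelow R g) g ((n : ℝ) • (x - y))
      = (∫ x in K, ∫ y in K, lostPairDensity lam (scale n (truncBelow R g)) (scale n g) x y)
        - volume.real K ^ 2 * m ^ 2 := by
    simp only [lostPairDensity_scale, ← hμ] at hi ⊢
    have hc : Integrable (fun q : E d × E d =>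
        covDensity μ (truncBelow R g) g ((n : ℝ) • (q.1 - q.2)))
        ((volume.restrict K).prod (volume.restrict K)) := hi.sub (integrable_const _)
    rw [integral_integral (f := fun x y => covDensity μ (truncBelow R g) g ((n : ℝ) • (x - y))) hc,
      integral_integral (f := fun x y =>
        lostPairDensity μ (truncBelow R g) g ((n : ℝ) • (x - y)) 0) hi]
    simp only [covDensity]
    rw [integral_sub hi (integrable_const _), integral_const, ← Set.univ_prod_univ,
      measureReal_prod_prod]
    simp [sq, hm]
  simp only [setIntegral_comp_smul_sub hK hn, integral_const_mul] at hcov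
  rw [hcov]
  ring

end RandomConnection

theorem mainTheorem4
    (d : ℕ) (hd : 1 ≤ d)
    (g : ℝ → ℝ) (hg : RandomConnection.IsConnectionFunction d g)
    (K : Set (RandomConnection.E d)) (hK_meas : MeasurableSet K)
    (hK_bdd : Bornology.IsBounded K) (hK_int : (interior K).Nonempty)
    (hK_bdry : volume (frontier K) = 0)
    (lam : ℝ) (hlam : 0 < lam)
    (lamSeq : ℕ → ℝ) (hlamSeq_pos : ∀ n, 1 ≤ n → 0 < lamSeq n)
    (hlamSeq : Tendsto (fun n : ℕ => lamSeq n / (n : ℝ) ^ d) atTop (𝓝 lam))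
    (Ω : ℕ → Type*) [∀ n, MeasurableSpace (Ω n)]
    (P : ∀ n, Measure (Ω n)) [∀ n, IsProbabilityMeasure (P n)]
    (ξ : ∀ n, ℕ → Ω n → RandomConnection.E d) (u : ∀ n, Sym2 ℕ → Ω n → ℝ)
    (hX : ∀ n, 1 ≤ n →
      RandomConnection.IsMarkedPoissonProcess (P n) (lamSeq n) (ξ n) (u n))
    (R : ℝ) (hR : 0 < R) :
    (∀ n, 1 ≤ n →
      (∀ᵐ ω ∂(P n), (RandomConnection.setL K g R n (fun i => ξ n i ω)
        (fun e => u n e ω)).Finite) ∧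
      MemLp (RandomConnection.L K g R n (ξ n) (u n)) 2 (P n)) ∧
    Tendsto
      (fun n : ℕ => (lamSeq n * volume.real K)⁻¹ *
        ∫ ω, RandomConnection.L K g R n (ξ n) (u n) ω ∂(P n))
      atTop
      (𝓝 (RandomConnection.p d lam (RandomConnection.truncBelow R g) *
        (1 - RandomConnection.p d lam (RandomConnection.truncAbove R g)))) ∧
    Integrable (fun x : RandomConnection.E d => RandomConnection.varIntegrand lam g R x) volume ∧
    Integrable (fun x : RandomConnection.E d => RandomConnection.extraIntegrand lam g R x) volume ∧
    Tendsto
      (fun n : ℕ => (lamSeq n * volume.real K)⁻¹ *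
        variance (RandomConnection.L K g R n (ξ n) (u n)) (P n))
      atTop
      (𝓝 (RandomConnection.p d lam (RandomConnection.truncBelow R g) *
          (1 - RandomConnection.p d lam (RandomConnection.truncAbove R g))
        + lam * (∫ x : RandomConnection.E d, RandomConnection.varIntegrand lam g R x)
        + lam * RandomConnection.p d lam (RandomConnection.truncBelow R g) ^ 2 *
          (∫ x : RandomConnection.E d, RandomConnection.extraIntegrand lam g R x))) := by
  have hP := hg.isProfile
  have hK' : volume K ≠ ⊤ := hK_bdd.measure_lt_top.ne
  have hK0 : 0 < volume.real K :=
    ENNReal.toReal_pos ((isOpen_interior.measure_pos volume hK_int).trans_le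
      (measure_mono interior_subset)).ne' hK'
  have hmom := fun (n : ℕ) (hn : 1 ≤ n) => RandomConnection.moments_L (hX n hn)
    (hlamSeq_pos n hn).le hd hP hK_meas hK_bdd hK_bdry R hn
  have hpR := RandomConnection.p_eq_mul_p_truncAbove (lam := lam) hP R
  have hmean : Tendsto (fun n : ℕ => RandomConnection.p d (lamSeq n / (n : ℝ) ^ d)
      (RandomConnection.truncBelow R g) - RandomConnection.p d (lamSeq n / (n : ℝ) ^ d) g) atTop
      (𝓝 (RandomConnection.p d lam (RandomConnection.truncBelow R g) *
        (1 - RandomConnection.p d lam (RandomConnection.truncAbove R g)))) := by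
    have e : RandomConnection.p d lam (RandomConnection.truncBelow R g) *
        (1 - RandomConnection.p d lam (RandomConnection.truncAbove R g))
        = RandomConnection.p d lam (RandomConnection.truncBelow R g)
          - RandomConnection.p d lam g := by
      rw [hpR]; ring
    rw [e]
    exact (((RandomConnection.continuous_p _).tendsto lam).comp hlamSeq).sub
      (((RandomConnection.continuous_p _).tendsto lam).comp hlamSeq)
  refine ⟨fun n hn => ⟨(hmom n hn).1, (hmom n hn).2.1⟩, ?_,
    RandomConnection.integrable_varIntegrand hlam.le hP,
    RandomConnection.integrable_extraIntegrand hlam.le hP, ?_⟩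
  · refine hmean.congr' ?_
    filter_upwards [eventually_ge_atTop 1] with n hn
    have h1 := (hlamSeq_pos n hn).ne'
    rw [(hmom n hn).2.2.1]
    field_simp
  · have hcov := RandomConnection.tendsto_setIntegral_covDensity hlam (hP.truncBelow R) hP
      (fun _ hr => hP.truncBelow_le hr) hK_meas hK_bdd hK_bdry hlamSeq
    have hlim := hmean.add (hlamSeq.mul (hcov.const_mul (volume.real K)⁻¹))
    rw [inv_mul_cancel_left₀ hK0.ne', RandomConnection.integral_covDensity hlam.le hP, mul_add,
      ← mul_assoc lam (RandomConnection.p d lam (RandomConnection.truncBelow R g) ^ 2),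
      ← add_assoc] at hlim
    refine hlim.congr' ?_
    filter_upwards [eventually_ge_atTop 1] with n hn
    have h1 := (hlamSeq_pos n hn).ne'
    have h2 : (n : ℝ) ≠ 0 := Nat.cast_ne_zero.mpr (by lia)
    rw [(hmom n hn).2.2.2]
    field_simp
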